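/- Setting. Let $d\ge 1$. For a finite alphabet $\mathcal A$, let $\Omega_{\mathcal A}=\mathcal A^{\mathbb Z^d}$ (product topology and Borel $\sigma$-algebra), with shifts $\sigma_k(\omega)_l=\omega_{k+l}$, and let $\mathcal M_{\mathcal A}$ be the set of shift-invariant probability measures on it. A finite set $\mathcal F$ of patterns $w\in\mathcal A^{I(w)}$ with finite windows $I(w)$ defines the subshift of finite type $\Omega_{\mathcal F}=\{\omega:\ \sigma_k(\omega)|_{I(w)}\ne w\ \ \forall w\in\mathcal F,\ k\in\mathbb Z^d\}$; $\mathcal M_{\mathcal F}$ is the set of $\mu\in\mathcal M_{\mathcal A}$ carried by $\Omega_{\mathcal F}$. Put $B_n=\{-n,\dots,n\}^d$. Noise. Let $\widetilde{\mathcal F}=\{(w,0^{I(w)}):w\in\mathcal F\}$, a set of patterns on $\mathcal A\times\{0,1\}$. For $\mathcal N\subset\mathcal M_{\{0,1\}}$ and $\epsilon\in[0,1]$, let $\mathcal M_{\mathcal F}^{\mathcal N}(\epsilon)$ be the set of images under $\pi_1$ of the measures $\lambda\in\mathcal M_{\widetilde{\mathcal F}}$ such that $\pi_2^*\lambda\in\mathcal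 N$ and $\pi_2^*\lambda(\{b: b_0=1\})\le\epsilon$. Let $\gamma_n(b)_k=\max_{j\in B_n}b_{k+j}$ for $b\in\{0,1\}^{\mathbb Z^d}$, and let $\gamma_n^*(\mathcal N)$ be the class of pushforwards of the elements of $\mathcal N$ under $\gamma_n$. Distance and stability. Let $d_H(x,y)=\limsup_n |\{k\in B_n:x_k\neq y_k\}|/|B_n|$ and, for $\mu,\nu\in\mathcal M_{\mathcal A}$, let $d_B(\mu,\nu)=\inf_\lambda\int d_H\,\mathrm d\lambda$, over the shift-invariant couplings $\lambda\in\mathcal M_{\mathcal A\times\mathcal A}$ of $\mu$ and $\nu$. For $f:[0,1]\to\mathbb R^+$, $\Omega_{\mathcal F}$ is $f$-stable (for $d_B$) on $\mathcal N$ if $f$ is non-decreasing, $f(0)=0$, $f$ is right-continuous at $0$, and $d_B(\mu,\mathcal M_{\mathcal F})=\inf_{\nu\in\mathcal M_{\mathcal F}}d_B(\mu,\nu)\le f(\epsilon)$ for all $\epsilon\in[0,1]$ and all $\mu\in\mathcal M_{\mathcal F}^{\mathcal N}(\epsilon)$. Reconstruction function. A pattern is locally admissible for $\mathcal F$ if it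 contains no pattern of $\mathcal F$, and globally admissible if it is the restriction of an element of $\Omega_{\mathcal F}$. For finite $S\subset\mathbb Z^d$, $\phi_{\mathcal F}(S)$ is the least $k\in\mathbb N$ such that, for every locally admissible pattern on $S+B_k$, its restriction to $S$ is globally admissible. Theorem (Conjugacy-Invariant Stability). Let $\mathcal F,\mathcal G$ be finite sets of forbidden patterns over finite alphabets $\mathcal A_1,\mathcal A_2$ on the same grid $\mathbb Z^d$, with $\Omega_{\mathcal F}\neq\emptyset$, and let $\theta:\Omega_{\mathcal F}\to\Omega_{\mathcal G}$ be a conjugacy, i.e. a continuous bijection commuting with all shifts. Then $\theta$ and $\theta^{-1}$ are defined by local rules: there are finite windows $J_\theta,J_{\theta^{-1}}\subset\mathbb Z^d$ and maps $\mathcal A_1^{J_\theta}\to\mathcal A_2$ and $\mathcal A_2^{J_{\theta^{-1}}}\to\mathcal A_1$ such that $\theta(x)_k$ is the value of the first at $(x_{k+j})_{j\in J_\theta}$, and similarly for $\theta^{-1}$. Moreover, for any such local rules, put $$r=\max_{w\in\mathcal F}\phi_{\mathcal G}\bigl(J_{\theta^{-1}}+I(w)\bigr)+\max_{c\in J_{\theta^{-1}}}\lVert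 c\rVert_\infty,\qquad D_\theta=|J_\theta|,\qquad C_{\theta^{-1}}=(2r+1)^d,$$ $$E=\bigl|J+B_{\phi_{\mathcal G}(J)}\bigr|\quad\text{with}\quad J=\{0\}\cup\bigl(J_{\theta^{-1}}+J_\theta\bigr)$$ (a maximum over the empty set being $0$). Then, for every $\mathcal N\subset\mathcal M_{\{0,1\}}$ and every $f:[0,1]\to\mathbb R^+$, if $\Omega_{\mathcal F}$ is $f$-stable for $d_B$ on $\gamma_r^*(\mathcal N)$, then $\Omega_{\mathcal G}$ is $g$-stable for $d_B$ on $\mathcal N$ with $$g(\epsilon)=D_\theta\, f\bigl(\min(C_{\theta^{-1}}\epsilon,1)\bigr)+E\,\epsilon .$$ -/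

import Mathlib

open MeasureTheory Filter Topology
open scoped Pointwise NNReal ENNReal unitInterval

namespace SFTStability

/-- The full shift `A ^ (ℤ ^ d)`, with the product topology and product σ-algebra. -/
abbrev Config (d : ℕ) (A : Type*) := (Fin d → ℤ) → A

/-- The shift `σ_k`, `(σ_k ω)_l = ω_{k + l}`. -/
def shift {d : ℕ} {A : Type*} (k : Fin d → ℤ) (x : Config d A) : Config d A :=
  fun l => x (k + l)

/-- A finite pattern: a letter on each cell of a finite window. -/
structure Pattern (d : ℕ) (A : Type*) where
  window : Finset (Fin d → ℤ)
  letter : window → A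

/-- The pattern `w` occurs in `x` at position `k`, that is `σ_k(x)|_{I(w)} = w`. -/
def Pattern.OccursAt {d : ℕ} {A : Type*} (w : Pattern d A) (x : Config d A)
    (k : Fin d → ℤ) : Prop :=
  ∀ i : w.window, shift k x i = w.letter i

/-- The subshift `Ω_F` of the configurations in which no pattern of `F` occurs. -/
def sft {d : ℕ} {A : Type*} (F : Set (Pattern d A)) : Set (Config d A) :=
  {x | ∀ w ∈ F, ∀ k, ¬ w.OccursAt x k}

theorem shift_mem_sft {d : ℕ} {A : Type*} {F : Set (Pattern d A)} {x : Config d A}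
    (hx : x ∈ sft F) (k : Fin d → ℤ) : shift k x ∈ sft F := by
  intro w hw l h
  refine hx w hw (k + l) fun i => ?_
  have := h i
  simpa [shift, add_assoc] using this

/-- The set `M_A` of shift-invariant probability measures on the full shift. -/
def invMeasures (d : ℕ) (A : Type*) [MeasurableSpace A] : Set (Measure (Config d A)) :=
  {μ | IsProbabilityMeasure μ ∧ ∀ k, μ.map (shift k) = μ}

/-- The set `M_F` of shift-invariant probability measures carried by `Ω_F`. -/
def sftMeasures {d : ℕ} {A : Type*} [MeasurableSpace A] (F : Set (Pattern d A)) :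
    Set (Measure (Config d A)) :=
  {μ | μ ∈ invMeasures d A ∧ ∀ᵐ x ∂μ, x ∈ sft F}

/-! ### Noise.  The noisy alphabet is `A × Bool`; the letter `(a, true)` is obscured and
`(a, false)` is clear. -/

/-- The clear pattern `(w, 0)` over the noisy alphabet. -/
def Pattern.clear {d : ℕ} {A : Type*} (w : Pattern d A) : Pattern d (A × Bool) where
  window := w.window
  letter := fun i => (w.letter i, false)

def proj₁ {d : ℕ} {A B : Type*} (x : Config d (A × B)) : Config d A := fun k => (x k).1

def proj₂ {d : ℕ} {A B : Type*} (x : Config d (A × B)) : Config d B := fun k => (x k).2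

/-- The measures on noisy configurations, without forbidden clear patterns, whose noise
belongs to the class `N` and obscures a given cell with probability at most `ε`. -/
def noisyMeasures {d : ℕ} {A : Type*} [MeasurableSpace A] (F : Set (Pattern d A))
    (N : Set (Measure (Config d Bool))) (ε : I) : Set (Measure (Config d (A × Bool))) :=
  {l | l ∈ sftMeasures (Pattern.clear '' F) ∧ l.map proj₂ ∈ N ∧
    l.map proj₂ {b | b 0 = true} ≤ ENNReal.ofReal ε}

/-- The projection `M_F^N(ε)` of the noisy measures to the full shift over `A`. -/
def noisyProj {d : ℕ} {A : Type*} [MeasurableSpace A] (F : Set (Pattern d A))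
    (N : Set (Measure (Config d Bool))) (ε : I) : Set (Measure (Config d A)) :=
  (fun l => l.map proj₁) '' noisyMeasures F N ε

/-! ### The Besicovitch distance -/

/-- The box `B_n = ⟦-n, n⟧ ^ d`. -/
noncomputable def box (d n : ℕ) : Finset (Fin d → ℤ) :=
  Fintype.piFinset fun _ => Finset.Icc (-(n : ℤ)) n

open Classical in
/-- The Hamming–Besicovitch pseudodistance: the upper density, along the boxes `B_n`, of
the set of cells where `x` and `y` differ. -/
noncomputable def hammingBesicovitch {d : ℕ} {A : Type*} (x y : Config d A) : ℝ≥0∞ :=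
  limsup (fun n : ℕ => (((box d n).filter fun k => x k ≠ y k).card : ℝ≥0∞) /
    ((box d n).card : ℝ≥0∞)) atTop

/-- Shift-invariant couplings of `μ` and `ν`. -/
def couplings {d : ℕ} {A : Type*} [MeasurableSpace A] (μ ν : Measure (Config d A)) :
    Set (Measure (Config d (A × A))) :=
  {l | l ∈ invMeasures d (A × A) ∧ l.map proj₁ = μ ∧ l.map proj₂ = ν}

/-- The Besicovitch distance `d_B`. -/
noncomputable def besicovitchDist {d : ℕ} {A : Type*} [MeasurableSpace A]
    (μ ν : Measure (Config d A)) : ℝ≥0∞ :=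
  ⨅ l ∈ couplings μ ν, ∫⁻ z, hammingBesicovitch (proj₁ z) (proj₂ z) ∂l

/-- A function `f : [0,1] → ℝ⁺` which is non-decreasing, vanishes at `0` and is
(right-)continuous at `0`. -/
def IsSpeed (f : I → ℝ≥0) : Prop :=
  Monotone f ∧ f 0 = 0 ∧ ContinuousAt f 0

/-- `Ω_F` is `f`-stable for `d_B` on the class of noises `N`. -/
def Stable {d : ℕ} {A : Type*} [MeasurableSpace A] (F : Set (Pattern d A))
    (N : Set (Measure (Config d Bool))) (f : I → ℝ≥0) : Prop :=
  IsSpeed f ∧ ∀ ε : I, ∀ μ ∈ noisyProj F N ε,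
    (⨅ ν ∈ sftMeasures F, besicovitchDist μ ν) ≤ (f ε : ℝ≥0∞)

/-! ### Conjugacies and their local rules -/

/-- A conjugacy: a continuous bijection between the two subshifts that commutes with all
shifts. -/
def IsConjugacy {d : ℕ} {A₁ A₂ : Type*} [TopologicalSpace A₁] [TopologicalSpace A₂]
    {F : Set (Pattern d A₁)} {G : Set (Pattern d A₂)} (θ : sft F ≃ sft G) : Prop :=
  Continuous θ ∧ ∀ (k : Fin d → ℤ) (x : sft F),
    (θ ⟨shift k x, shift_mem_sft x.2 k⟩ : Config d A₂) = shift k (θ x)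

/-- A local rule `A₁ ^ J → A₂` on a finite window `J`. -/
structure LocalRule (d : ℕ) (A₁ A₂ : Type*) where
  window : Finset (Fin d → ℤ)
  rule : (window → A₁) → A₂

/-- The extension of a local rule to the full shift. -/
def LocalRule.toMap {d : ℕ} {A₁ A₂ : Type*} (T : LocalRule d A₁ A₂) (x : Config d A₁) :
    Config d A₂ :=
  fun k => T.rule fun j => x (k + j)

/-- The local rule `T` defines the map `θ : Ω_F → Ω_G`. -/
def LocalRule.Defines {d : ℕ} {A₁ A₂ : Type*} {F : Set (Pattern d A₁)}
    {G : Set (Pattern d A₂)} (T : LocalRule d A₁ A₂) (θ : sft F → sft G) : Prop :=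
  ∀ x : sft F, T.toMap x = θ x

/-! ### Admissibility, reconstruction and the constants -/

/-- The restriction of `x` to `S` contains no forbidden pattern. -/
def LocallyAdmissibleOn {d : ℕ} {A : Type*} (F : Set (Pattern d A)) (x : Config d A)
    (S : Finset (Fin d → ℤ)) : Prop :=
  ∀ w ∈ F, ∀ k, (∀ i ∈ w.window, k + i ∈ S) → ¬ w.OccursAt x k

/-- The restriction of `x` to `S` extends to a configuration of `Ω_F`. -/
def GloballyAdmissibleOn {d : ℕ} {A : Type*} (F : Set (Pattern d A)) (x : Config d A)
    (S : Finset (Fin d → ℤ)) : Prop :=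
  ∃ y ∈ sft F, ∀ i ∈ S, y i = x i

/-- The reconstruction function `φ_F(S)`: the least `k` such that, whenever a pattern on
`S + B_k` is locally admissible, its restriction to `S` is globally admissible. Patterns are
written as restrictions of configurations `x`. -/
noncomputable def reconstruction {d : ℕ} {A : Type*} (F : Set (Pattern d A))
    (S : Finset (Fin d → ℤ)) : ℕ :=
  sInf {k : ℕ | ∀ x : Config d A, LocallyAdmissibleOn F x (S + box d k) →
    GloballyAdmissibleOn F x S}

/-- `max_{c ∈ J} ‖c‖_∞`. -/
def maxNorm {d : ℕ} (J : Finset (Fin d → ℤ)) : ℕ :=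
  J.sup fun c => Finset.univ.sup fun i => (c i).natAbs

/-- The radius `r_T = max_{w ∈ G} φ_F(J + I(w)) + max_{c ∈ J} ‖c‖_∞` of a local rule `T`
with window `J` defining a morphism `Ω_F → Ω_G`. -/
noncomputable def LocalRule.radius {d : ℕ} {A₁ A₂ : Type*} (T : LocalRule d A₁ A₂)
    (F : Finset (Pattern d A₁)) (G : Finset (Pattern d A₂)) : ℕ :=
  (G.sup fun w => reconstruction (F : Set (Pattern d A₁)) (T.window + w.window)) +
    maxNorm T.window

/-- `D_T = |J|`. -/
def LocalRule.constD {d : ℕ} {A₁ A₂ : Type*} (T : LocalRule d A₁ A₂) : ℕ :=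
  T.window.card

/-- `C_T = (2 r_T + 1) ^ d`. -/
noncomputable def LocalRule.constC {d : ℕ} {A₁ A₂ : Type*} (T : LocalRule d A₁ A₂)
    (F : Finset (Pattern d A₁)) (G : Finset (Pattern d A₂)) : ℕ :=
  (2 * T.radius F G + 1) ^ d

/-- `E = |J + B_{φ_G(J)}|` with `J = {0} ∪ (J_{T'} + J_T)`, for local rules `T` of
`θ : Ω_F → Ω_G` and `T'` of `θ⁻¹`. -/
noncomputable def constE {d : ℕ} {A₁ A₂ : Type*} (T : LocalRule d A₁ A₂)
    (T' : LocalRule d A₂ A₁) (G : Finset (Pattern d A₂)) : ℕ :=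
  let J : Finset (Fin d → ℤ) := {0} ∪ (T'.window + T.window)
  (J + box d (reconstruction (G : Set (Pattern d A₂)) J)).card

/-- The thickening `γ_n(b)_k = max_{j ∈ B_n} b_{k + j}`. -/
noncomputable def thicken {d : ℕ} (n : ℕ) (b : Config d Bool) : Config d Bool :=
  fun k => (box d n).sup fun j => b (k + j)

/-- The class `γ_n^*(N)`. -/
noncomputable def thickenClass {d : ℕ} (n : ℕ) (N : Set (Measure (Config d Bool))) :
    Set (Measure (Config d Bool)) :=
  (fun ν => ν.map (thicken n)) '' N

/-- The speed `ε ↦ D f(min(C ε, 1)) + E ε`. -/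
noncomputable def newSpeed (D C E : ℕ) (f : I → ℝ≥0) : I → ℝ≥0 :=
  fun ε => (D : ℝ≥0) * f (Set.projIcc 0 1 zero_le_one ((C : ℝ) * (ε : ℝ))) +
    (E : ℝ≥0) * Real.toNNReal ε

end SFTStability

/-!
Let `T` and `T'` be local rules of `θ` and `θ⁻¹`. Given a noisy measure `l` for `Ω_G`, apply `T'` to
its first layer and thicken its noise by `B_r` (`LocalRule.noisyMap`). Where the thickened noise is
clear, the first layer is locally admissible on a set so large that, around the cells that matter,
it coincides with a configuration of `Ω_G`, whose image under `T'` belongs to `Ω_F`. So the image of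
`l` is a noisy measure for `Ω_F`, with noise rate at most `min (C ε) 1`
(`LocalRule.map_noisyMap_mem`), and stability of `Ω_F` gives a coupling `κ` of its first layer
`T'(x)` with some `y` whose law is carried by `Ω_F`, at a cost close to `f (min (C ε) 1)` or less.

Gluing `κ` to the law of `x` along `T'` (`glue`) gives an invariant joint law of `(x, y)`, hence a
coupling of `x` with `T(y)` (`exists_coupling_map`). The configurations `x` and `T(y)` differ at the
origin only if `x` and `T(T'(x))` do, which forces one of the `E` cells of `J + B_{φ_G(J)}` to be
obscured (`measure_toMap_toMap_ne_le`), or if `T'(x)` and `y` differ on the window of `T`, which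
has `D` cells. The radii `φ_G` are minima of nonempty sets by compactness
(`exists_locallyAdmissibleOn_imp`).

This counts disagreements at the origin, whereas `d_B` integrates an upper density. The two agree
for every invariant coupling (`lintegral_hammingBesicovitch`), by the reverse Fatou lemma and by the
inequality `∫ limsup A_n u ≤ ∫ u` for averages along the boxes of `ℤ ^ d` and `0 ≤ u ≤ 1`
(`lintegral_limsup_avg_box_le`). For one transformation this is the tiling argument of Katznelson
and Weiss (`lintegral_limsup_birkhoffSum_div_le`). It extends to a sequence of functions, in the
form `∫ limsup A_n u_n ≤ ∫ limsup u_n` (`lintegral_limsup_avg_seq_le`), and then to `ℤ ^ d` by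
averaging one coordinate at a time.

The existence of local rules is the Curtis–Hedlund–Lyndon theorem (`exists_localRule_defines`),
applied to `θ` and to `θ⁻¹`, the latter being continuous because `Ω_F` is compact.
-/

namespace SFTStability

/-! ### The ergodic inequality for one transformation -/

theorem ennreal_limsup_add_le (u v : ℕ → ℝ≥0∞) :
    limsup (fun n => u n + v n) atTop ≤ limsup u atTop + limsup v atTop := by
  refine ENNReal.le_of_forall_pos_le_add fun ε hε hfin => ?_
  have hu : limsup u atTop ≠ ∞ := (ENNReal.add_lt_top.1 hfin).1.ne
  have hv : limsup v atTop ≠ ∞ := (ENNReal.add_lt_top.1 hfin).2.ne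
  have hε2 : (ε : ℝ≥0∞) / 2 ≠ 0 := by simpa using hε.ne'
  have h1 := eventually_lt_of_limsup_lt (ENNReal.lt_add_right hu hε2)
  have h2 := eventually_lt_of_limsup_lt (ENNReal.lt_add_right hv hε2)
  refine limsup_le_of_le (by isBoundedDefault) ?_
  filter_upwards [h1, h2] with n h1 h2
  calc u n + v n ≤ (limsup u atTop + ε / 2) + (limsup v atTop + ε / 2) := by gcongr
    _ = limsup u atTop + limsup v atTop + (ε / 2 + ε / 2) := by ring
    _ = _ := by rw [ENNReal.add_halves]

theorem limsup_div_le_of_le_add_const {u v : ℕ → ℝ≥0∞} (c : ℝ≥0∞) (hc : c ≠ ∞)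
    (h : ∀ n, u n ≤ v n + c) :
    limsup (fun n => u n / n) atTop ≤ limsup (fun n => v n / n) atTop := by
  have h0 : limsup (fun n : ℕ => c / n) atTop = 0 := by
    refine Tendsto.limsup_eq ?_
    simpa [div_eq_mul_inv] using
      ENNReal.Tendsto.const_mul ENNReal.tendsto_inv_nat_nhds_zero (Or.inr hc)
  calc limsup (fun n => u n / n) atTop ≤ limsup (fun n : ℕ => v n / n + c / n) atTop := by
        refine limsup_le_limsup (Eventually.of_forall fun n => ?_)
        simp only [← ENNReal.add_div]
        gcongr
        exact h n
    _ ≤ _ := by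
        refine (ennreal_limsup_add_le _ _).trans ?_
        rw [h0, add_zero]

/-- Every orbit segment of length `L` is tiled, up to at most `M` terms, by segments of length at
most `M` on which the Birkhoff sum of `g` is at least the length times the invariant value
`c x`. -/
theorem mul_le_birkhoffSum_add {Ω : Type*} {T : Ω → Ω} {g c : Ω → ℝ≥0∞} (hc1 : ∀ x, c x ≤ 1)
    (hcT : ∀ x, c (T x) = c x) {M : ℕ}
    (h : ∀ x, ∃ n, 0 < n ∧ n ≤ M ∧ n * c x ≤ birkhoffSum T g n x) (L : ℕ) (x : Ω) :
    L * c x ≤ birkhoffSum T g L x + M := by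
  induction L using Nat.strong_induction_on generalizing x with
  | _ L ih =>
    rcases le_or_gt L M with hL | hL
    · calc (L : ℝ≥0∞) * c x ≤ L * 1 := by gcongr; exact hc1 x
        _ ≤ M := by simpa using hL
        _ ≤ _ := le_add_self
    · obtain ⟨n, hn, hnM, hx⟩ := h x
      have hcn : c (T^[n] x) = c x := by
        clear hx hnM hn
        induction n with
        | zero => rfl
        | succ n ihn => rw [Function.iterate_succ_apply', hcT, ihn]
      have hrec := ih (L - n) (by omega) (T^[n] x)
      rw [hcn] at hrec
      have hL' : L = n + (L - n) := by omega
      calc (L : ℝ≥0∞) * c x = n * c x + (L - n : ℕ) * c x := by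
            rw [← add_mul, ← Nat.cast_add, ← hL']
        _ ≤ birkhoffSum T g n x + (birkhoffSum T g (L - n) (T^[n] x) + M) := by gcongr
        _ = birkhoffSum T g L x + M := by
            rw [← add_assoc, ← birkhoffSum_add, ← hL']

theorem le_of_forall_nat_mul_le_add {a b : ℝ≥0∞} {M : ℕ} (h : ∀ L : ℕ, L * a ≤ L * b + M) :
    a ≤ b := by
  have ht : Tendsto (fun L : ℕ => b + M / L) atTop (𝓝 (b + 0)) := by
    refine tendsto_const_nhds.add ?_
    simpa [div_eq_mul_inv] using
      ENNReal.Tendsto.const_mul ENNReal.tendsto_inv_nat_nhds_zero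
        (Or.inr (ENNReal.natCast_ne_top M))
  rw [add_zero] at ht
  refine ge_of_tendsto ht ?_
  filter_upwards [eventually_gt_atTop 0] with L hL
  have hL0 : (L : ℝ≥0∞) ≠ 0 := by exact_mod_cast hL.ne'
  have hLt : (L : ℝ≥0∞) ≠ ∞ := ENNReal.natCast_ne_top L
  calc a = L * a / L := by rw [mul_comm, ENNReal.mul_div_cancel_right hL0 hLt]
    _ ≤ (L * b + M) / L := by gcongr; exact h L
    _ = b + M / L := by
        rw [ENNReal.add_div, mul_comm, ENNReal.mul_div_cancel_right hL0 hLt]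

theorem measurable_birkhoffSum {Ω : Type*} [MeasurableSpace Ω] {T : Ω → Ω} (hT : Measurable T)
    {g : Ω → ℝ≥0∞} (hg : Measurable g) (n : ℕ) : Measurable (birkhoffSum T g n) := by
  unfold birkhoffSum
  exact Finset.measurable_sum _ fun k _ => hg.comp (hT.iterate k)

theorem lintegral_birkhoffSum {Ω : Type*} [MeasurableSpace Ω] {μ : Measure Ω} {T : Ω → Ω}
    (hT : MeasurePreserving T μ μ) {g : Ω → ℝ≥0∞} (hg : Measurable g) (n : ℕ) :
    ∫⁻ x, birkhoffSum T g n x ∂μ = n * ∫⁻ x, g x ∂μ := by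
  unfold birkhoffSum
  rw [lintegral_finsetSum _ fun k _ => by exact hg.comp (hT.measurable.iterate k)]
  simp [(hT.iterate _).lintegral_comp hg]

theorem birkhoffSum_le {Ω : Type*} {T : Ω → Ω} {g : Ω → ℝ≥0∞} (hg1 : ∀ x, g x ≤ 1)
    (n : ℕ) (x : Ω) : birkhoffSum T g n x ≤ n := by
  unfold birkhoffSum
  refine (Finset.sum_le_sum fun k _ => hg1 _).trans ?_
  simp

/-- The upper limit of the Birkhoff averages is invariant. -/
theorem limsup_birkhoffSum_div_comp {Ω : Type*} {T : Ω → Ω} {g : Ω → ℝ≥0∞} (hg1 : ∀ x, g x ≤ 1)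
    (x : Ω) : limsup (fun n : ℕ => birkhoffSum T g n (T x) / n) atTop =
      limsup (fun n : ℕ => birkhoffSum T g n x / n) atTop := by
  have key : ∀ n, birkhoffSum T g n x + g (T^[n] x) = g x + birkhoffSum T g n (T x) := fun n => by
    rw [← birkhoffSum_succ, birkhoffSum_succ']
  refine le_antisymm (limsup_div_le_of_le_add_const 1 (by simp) fun n => ?_)
    (limsup_div_le_of_le_add_const 1 (by simp) fun n => ?_)
  · calc _ ≤ g x + birkhoffSum T g n (T x) := le_add_self
      _ = birkhoffSum T g n x + g (T^[n] x) := (key n).symm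
      _ ≤ _ := by gcongr; exact hg1 _
  · calc _ ≤ birkhoffSum T g n x + g (T^[n] x) := le_self_add
      _ = g x + birkhoffSum T g n (T x) := key n
      _ = birkhoffSum T g n (T x) + g x := add_comm _ _
      _ ≤ _ := by gcongr; exact hg1 _

/-- The upper half of the pointwise ergodic theorem for a function with values in `[0, 1]`. The
set of points which do not reach the level `limsup - δ` within `M` steps has small measure; adding
its indicator to `g` makes `mul_le_birkhoffSum_add` applicable at every point. -/
theorem lintegral_limsup_birkhoffSum_div_le {Ω : Type*} [MeasurableSpace Ω] {μ : Measure Ω}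
    [IsProbabilityMeasure μ] {T : Ω → Ω} (hT : MeasurePreserving T μ μ) {g : Ω → ℝ≥0∞}
    (hg : Measurable g) (hg1 : ∀ x, g x ≤ 1) :
    ∫⁻ x, limsup (fun n : ℕ => birkhoffSum T g n x / n) atTop ∂μ ≤ ∫⁻ x, g x ∂μ := by
  set F : Ω → ℝ≥0∞ := fun x => limsup (fun n : ℕ => birkhoffSum T g n x / n) atTop with hFdef
  have hSm : ∀ n, Measurable (birkhoffSum T g n) := measurable_birkhoffSum hT.measurable hg
  have hFm : Measurable F := Measurable.limsup fun n => (hSm n).div_const _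
  have hF1 : ∀ x, F x ≤ 1 := fun x => by
    refine limsup_le_of_le (by isBoundedDefault) (Eventually.of_forall fun n => ?_)
    exact ENNReal.div_le_of_le_mul (by simpa using birkhoffSum_le hg1 n x)
  refine ENNReal.le_of_forall_pos_le_add fun ε hε _ => ?_
  set δ : ℝ≥0∞ := ε / 2 with hδ
  have hδ0 : δ ≠ 0 := by simpa [hδ] using hε.ne'
  set c : Ω → ℝ≥0∞ := fun x => F x - δ
  have hcm : Measurable c := hFm.sub_const δ
  have hreach : ∀ x, ∃ n : ℕ, 0 < n ∧ n * c x ≤ birkhoffSum T g n x := fun x => by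
    rcases eq_or_ne (F x) 0 with h0 | h0
    · exact ⟨1, one_pos, by simp [c, h0]⟩
    · have hlt : c x < F x :=
        ENNReal.sub_lt_self ((hF1 x).trans_lt ENNReal.one_lt_top).ne h0 hδ0
      obtain ⟨n, hn, hn0⟩ := ((frequently_lt_of_lt_limsup (by isBoundedDefault) hlt).and_eventually
        (eventually_gt_atTop 0)).exists
      exact ⟨n, hn0, ENNReal.mul_le_of_le_div' hn.le⟩
  -- The points that no length at most `M` brings to the level `c`.
  let bad : ℕ → Set Ω := fun M =>
    ⋂ n ∈ Finset.Icc 1 M, {x | birkhoffSum T g n x < n * c x}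
  have hbadm : ∀ M, MeasurableSet (bad M) := fun M =>
    Finset.measurableSet_biInter _ fun n _ => measurableSet_lt (hSm n) (hcm.const_mul _)
  have hbad0 : Tendsto (fun M => μ (bad M)) atTop (𝓝 0) := by
    have hanti : Antitone bad := fun M M' h x hx => by
      simp only [bad, Set.mem_iInter, Finset.mem_Icc] at hx ⊢
      exact fun n hn => hx n ⟨hn.1, hn.2.trans h⟩
    have hempty : ⋂ M, bad M = ∅ := by
      refine Set.eq_empty_of_forall_notMem fun x hx => ?_
      obtain ⟨n, hn, hnx⟩ := hreach x
      have := Set.mem_iInter.1 hx n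
      simp only [bad, Set.mem_iInter, Finset.mem_Icc] at this
      exact absurd hnx (not_le.2 (this n ⟨hn, le_rfl⟩))
    have := tendsto_measure_iInter_atTop (μ := μ) (fun M => (hbadm M).nullMeasurableSet) hanti
      ⟨0, measure_ne_top _ _⟩
    rwa [hempty, measure_empty] at this
  obtain ⟨M, hM, hM1⟩ := ((hbad0.eventually (gt_mem_nhds (pos_iff_ne_zero.2 hδ0))).and
    (eventually_ge_atTop 1)).exists
  set g' : Ω → ℝ≥0∞ := fun x => g x + (bad M).indicator 1 x with hg'
  have hind : Measurable ((bad M).indicator (1 : Ω → ℝ≥0∞)) := measurable_one.indicator (hbadm M)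
  have hg'm : Measurable g' := hg.add hind
  have htile : ∀ x, ∃ n : ℕ, 0 < n ∧ n ≤ M ∧ n * c x ≤ birkhoffSum T g' n x := fun x => by
    by_cases hx : x ∈ bad M
    · refine ⟨1, one_pos, hM1, ?_⟩
      have : c x ≤ 1 := tsub_le_self.trans (hF1 x)
      simpa [birkhoffSum_one, hg', hx] using this.trans le_add_self
    · simp only [bad, Set.mem_iInter, Finset.mem_Icc, not_forall, Set.mem_ofPred_eq, not_lt] at hx
      obtain ⟨n, hn, hnx⟩ := hx
      refine ⟨n, hn.1, hn.2, hnx.trans ?_⟩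
      exact Finset.sum_le_sum fun k _ => le_self_add
  have hmain := mul_le_birkhoffSum_add (fun x => tsub_le_self.trans (hF1 x))
    (fun x => by simp only [hFdef, limsup_birkhoffSum_div_comp hg1]) htile
  have hc_int : ∫⁻ x, c x ∂μ ≤ ∫⁻ x, g' x ∂μ := by
    refine le_of_forall_nat_mul_le_add (M := M) fun L => ?_
    calc (L : ℝ≥0∞) * ∫⁻ x, c x ∂μ = ∫⁻ x, L * c x ∂μ := (lintegral_const_mul _ hcm).symm
      _ ≤ ∫⁻ x, birkhoffSum T g' L x + M ∂μ := lintegral_mono fun x => hmain L x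
      _ = L * ∫⁻ x, g' x ∂μ + M := by
          rw [lintegral_add_right _ measurable_const, lintegral_birkhoffSum hT hg'm]
          simp
  calc ∫⁻ x, F x ∂μ ≤ ∫⁻ x, c x + δ ∂μ := lintegral_mono fun x => le_tsub_add
    _ = ∫⁻ x, c x ∂μ + δ := by rw [lintegral_add_right _ measurable_const]; simp
    _ ≤ (∫⁻ x, g x ∂μ + δ) + δ := by
        gcongr
        refine hc_int.trans ?_
        rw [hg', lintegral_add_right _ hind, lintegral_indicator_one (hbadm M)]
        gcongr
    _ = _ := by rw [add_assoc, hδ, ENNReal.add_halves]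

/-! ### The ergodic inequality for actions of `ℤ ^ d` along boxes -/

theorem sum_Icc_neg_le (n : ℕ) (h : ℤ → ℝ≥0∞) :
    ∑ a ∈ Finset.Icc (-(n : ℤ)) n, h a ≤
      ∑ k ∈ Finset.range (n + 1), h k + ∑ k ∈ Finset.range (n + 1), h (-k) := by
  have hsub : Finset.Icc (-(n : ℤ)) n ⊆ (Finset.range (n + 1)).image (fun k : ℕ => (k : ℤ)) ∪
      (Finset.range (n + 1)).image (fun k : ℕ => -(k : ℤ)) := by
    intro a ha
    rw [Finset.mem_Icc] at ha
    simp only [Finset.mem_union, Finset.mem_image, Finset.mem_range]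
    rcases le_total 0 a with h0 | h0
    · exact Or.inl ⟨a.toNat, by omega, by omega⟩
    · exact Or.inr ⟨(-a).toNat, by omega, by omega⟩
  refine (Finset.sum_le_sum_of_subset hsub).trans (le_self_add.trans
    (Finset.sum_union_inter (f := h)).le |>.trans ?_)
  rw [Finset.sum_image fun a _ b _ hab => by simpa using hab,
    Finset.sum_image fun a _ b _ hab => by simpa using hab]

/-- The ergodic inequality for two-sided averages, from those of `ψ 1` and `ψ (-1)`. -/
theorem lintegral_limsup_avg_int_le {Ω : Type*} [MeasurableSpace Ω] {μ : Measure Ω}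
    [IsProbabilityMeasure μ] {ψ : ℤ → Ω → Ω} (h0 : ψ 0 = id)
    (hadd : ∀ a b, ψ (a + b) = ψ a ∘ ψ b) (hψ : ∀ a, MeasurePreserving (ψ a) μ μ)
    {g : Ω → ℝ≥0∞} (hg : Measurable g) (hg1 : ∀ x, g x ≤ 1) :
    ∫⁻ x, limsup (fun n : ℕ => (∑ a ∈ Finset.Icc (-(n : ℤ)) n, g (ψ a x)) / (2 * n + 1 : ℕ))
      atTop ∂μ ≤ ∫⁻ x, g x ∂μ := by
  have hpos : ∀ k : ℕ, ψ k = (ψ 1)^[k] := fun k => by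
    induction k with
    | zero => simpa using h0
    | succ k ih => rw [Function.iterate_succ, ← ih, ← hadd]; push_cast; rfl
  have hneg : ∀ k : ℕ, ψ (-k) = (ψ (-1))^[k] := fun k => by
    induction k with
    | zero => simpa using h0
    | succ k ih => rw [Function.iterate_succ, ← ih, ← hadd]; congr 1; push_cast; ring
  set U : Ω → ℝ≥0∞ := fun x => limsup (fun n : ℕ => birkhoffSum (ψ 1) g n x / n) atTop
  set V : Ω → ℝ≥0∞ := fun x => limsup (fun n : ℕ => birkhoffSum (ψ (-1)) g n x / n) atTop
  have hU : Measurable U := Measurable.limsup fun n =>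
    (measurable_birkhoffSum (hψ 1).measurable hg n).div_const _
  have hpt : ∀ x, limsup (fun n : ℕ => (∑ a ∈ Finset.Icc (-(n : ℤ)) n, g (ψ a x)) /
      (2 * n + 1 : ℕ)) atTop ≤ 2⁻¹ * (U x + V x) := fun x => by
    set W : ℕ → ℝ≥0∞ := fun n => ∑ a ∈ Finset.Icc (-(n : ℤ)) n, g (ψ a x)
    have hW : ∀ n, W n ≤ (birkhoffSum (ψ 1) g n x + birkhoffSum (ψ (-1)) g n x) + 2 := fun n => by
      refine (sum_Icc_neg_le n fun a => g (ψ a x)).trans ?_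
      simp only [hpos, hneg]
      change birkhoffSum (ψ 1) g (n + 1) x + birkhoffSum (ψ (-1)) g (n + 1) x ≤ _
      rw [birkhoffSum_succ, birkhoffSum_succ, add_add_add_comm, ← one_add_one_eq_two]
      gcongr <;> exact hg1 _
    calc limsup (fun n : ℕ => W n / (2 * n + 1 : ℕ)) atTop
        ≤ limsup (fun n : ℕ => 2⁻¹ * (W n / n)) atTop := by
          refine limsup_le_limsup (Eventually.of_forall fun n => ?_)
          calc W n / (2 * n + 1 : ℕ) ≤ W n / (2 * n : ℕ) := by gcongr; omega
            _ = 2⁻¹ * (W n / n) := by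
              push_cast
              rw [div_eq_mul_inv, ENNReal.mul_inv (by simp) (by simp), div_eq_mul_inv]
              ring
      _ = 2⁻¹ * limsup (fun n : ℕ => W n / n) atTop :=
          ENNReal.limsup_const_mul_of_ne_top (by simp)
      _ ≤ 2⁻¹ * (U x + V x) := by
          gcongr
          refine (limsup_div_le_of_le_add_const 2 (by simp) hW).trans ?_
          simp only [ENNReal.add_div]
          exact ennreal_limsup_add_le _ _
  calc _ ≤ ∫⁻ x, 2⁻¹ * (U x + V x) ∂μ := lintegral_mono hpt
    _ = 2⁻¹ * (∫⁻ x, U x ∂μ + ∫⁻ x, V x ∂μ) := by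
        rw [lintegral_const_mul' _ _ (by simp), lintegral_add_left hU]
    _ ≤ 2⁻¹ * (∫⁻ x, g x ∂μ + ∫⁻ x, g x ∂μ) := by
        gcongr 2⁻¹ * (?_ + ?_)
        · exact lintegral_limsup_birkhoffSum_div_le (hψ 1) hg hg1
        · exact lintegral_limsup_birkhoffSum_div_le (hψ (-1)) hg hg1
    _ = _ := by
        rw [← two_mul, ← mul_assoc, ENNReal.inv_mul_cancel (by simp) (by simp), one_mul]

/-- The ergodic inequality for averages of a varying function: the tail suprema
`sup_{k ≥ m} u k` dominate the sequence and decrease to `limsup u`. -/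
theorem lintegral_limsup_avg_seq_le {Ω : Type*} [MeasurableSpace Ω] {μ : Measure Ω}
    [IsProbabilityMeasure μ] {ψ : ℤ → Ω → Ω} (h0 : ψ 0 = id)
    (hadd : ∀ a b, ψ (a + b) = ψ a ∘ ψ b) (hψ : ∀ a, MeasurePreserving (ψ a) μ μ)
    {u : ℕ → Ω → ℝ≥0∞} (hu : ∀ n, Measurable (u n)) (hu1 : ∀ n x, u n x ≤ 1) :
    ∫⁻ x, limsup (fun n : ℕ => (∑ a ∈ Finset.Icc (-(n : ℤ)) n, u n (ψ a x)) / (2 * n + 1 : ℕ))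
      atTop ∂μ ≤ ∫⁻ x, limsup (fun n => u n x) atTop ∂μ := by
  set S : ℕ → Ω → ℝ≥0∞ := fun m x => ⨆ k, u (k + m) x with hS
  have hSm : ∀ m, Measurable (S m) := fun m => Measurable.iSup fun k => hu _
  have hS1 : ∀ m x, S m x ≤ 1 := fun m x => iSup_le fun k => hu1 _ _
  have hSanti : Antitone S := fun m m' h x => iSup_le fun k => by
    refine le_trans (le_of_eq ?_) (le_iSup (fun k => u (k + m) x) (k + (m' - m)))
    congr 1; omega
  have hlim : ∀ x, limsup (fun n => u n x) atTop = ⨅ m, S m x := fun x =>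
    limsup_eq_iInf_iSup_of_nat'
  simp_rw [hlim]
  rw [lintegral_iInf hSm hSanti
    (ne_top_of_le_ne_top ENNReal.one_ne_top ((lintegral_mono (hS1 0)).trans (by simp)))]
  refine le_iInf fun m => le_trans (lintegral_mono fun x => ?_)
    (lintegral_limsup_avg_int_le h0 hadd hψ (hSm m) (hS1 m))
  refine limsup_le_limsup ?_
  filter_upwards [eventually_ge_atTop m] with n hn
  gcongr with a
  refine le_trans (le_of_eq ?_) (le_iSup (fun k => u (k + m) (ψ a x)) (n - m))
  congr 1; omega

theorem card_box (d n : ℕ) : (box d n).card = (2 * n + 1) ^ d := by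
  rw [box, Fintype.card_piFinset_const, Int.card_Icc]
  congr 1
  omega

theorem mem_box {d n : ℕ} {k : Fin d → ℤ} : k ∈ box d n ↔ ∀ i, (k i).natAbs ≤ n := by
  simp only [box, Fintype.mem_piFinset, Finset.mem_Icc]
  exact forall_congr' fun i => by omega

theorem sum_box_succ (d n : ℕ) (h : (Fin (d + 1) → ℤ) → ℝ≥0∞) :
    ∑ k ∈ box (d + 1) n, h k =
      ∑ a ∈ Finset.Icc (-(n : ℤ)) n, ∑ l ∈ box d n, h (Fin.cons a l) := by
  rw [← Finset.sum_product']
  refine Finset.sum_nbij' (fun k => (k 0, Fin.tail k)) (fun p => Fin.cons p.1 p.2) ?_ ?_ ?_ ?_ ?_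
  · intro k hk
    simp only [box, Fintype.mem_piFinset, Finset.mem_product] at hk ⊢
    exact ⟨hk 0, fun i => hk i.succ⟩
  · rintro ⟨a, l⟩ hp
    simp only [box, Fintype.mem_piFinset, Finset.mem_product] at hp ⊢
    exact Fin.cases (by simpa using hp.1) fun i => by simpa using hp.2 i
  · intro k _; exact Fin.cons_self_tail k
  · rintro ⟨a, l⟩ _; simp
  · intro k _; rw [Fin.cons_self_tail]

/-- The upper half of the pointwise ergodic theorem for a measure-preserving action of `ℤ ^ d`,
along the boxes `B_n`, for a function with values in `[0, 1]`. The average over a box is an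
iterated average, one coordinate at a time. -/
theorem lintegral_limsup_avg_box_le {Ω : Type*} [MeasurableSpace Ω] {μ : Measure Ω}
    [IsProbabilityMeasure μ] (d : ℕ) {φ : (Fin d → ℤ) → Ω → Ω} (h0 : φ 0 = id)
    (hadd : ∀ a b, φ (a + b) = φ a ∘ φ b) (hφ : ∀ a, MeasurePreserving (φ a) μ μ)
    {u : Ω → ℝ≥0∞} (hu : Measurable u) (hu1 : ∀ x, u x ≤ 1) :
    ∫⁻ x, limsup (fun n : ℕ => (∑ k ∈ box d n, u (φ k x)) / ((box d n).card : ℝ≥0∞)) atTop ∂μ ≤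
      ∫⁻ x, u x ∂μ := by
  induction d with
  | zero =>
    have hbox : ∀ n, box 0 n = {0} := fun n => by
      ext k; simp [mem_box, Subsingleton.elim k 0]
    simp only [hbox, Finset.sum_singleton, h0, id_eq, Finset.card_singleton, Nat.cast_one, div_one,
      limsup_const, le_refl]
  | succ d ih =>
    have hcons : ∀ (a : ℤ) (l : Fin d → ℤ),
        (Fin.cons a l : Fin (d + 1) → ℤ) = Fin.cons 0 l + Fin.cons a 0 := fun a l => by
      funext i
      refine Fin.cases ?_ (fun i => ?_) i <;> simp
    set φ' : (Fin d → ℤ) → Ω → Ω := fun l => φ (Fin.cons 0 l)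
    set ψ : ℤ → Ω → Ω := fun a => φ (Fin.cons a 0)
    have hz : (Fin.cons 0 0 : Fin (d + 1) → ℤ) = 0 := by
      funext i; refine Fin.cases ?_ (fun i => ?_) i <;> simp
    have ih' := ih (φ := φ') (by simpa [φ', hz] using h0)
      (fun a b => by
        simp only [φ', ← hadd]; congr 1
        funext i; refine Fin.cases ?_ (fun i => ?_) i <;> simp)
      (fun a => hφ _)
    set v : ℕ → Ω → ℝ≥0∞ := fun n x => (∑ l ∈ box d n, u (φ' l x)) / ((box d n).card : ℝ≥0∞)
    have hv : ∀ n, Measurable (v n) := fun n =>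
      (Finset.measurable_sum _ fun l _ => hu.comp (hφ _).measurable).div_const _
    have hv1 : ∀ n x, v n x ≤ 1 := fun n x => by
      refine ENNReal.div_le_of_le_mul ?_
      refine (Finset.sum_le_sum fun l _ => hu1 _).trans ?_
      simp
    refine le_trans (le_of_eq ?_) ((lintegral_limsup_avg_seq_le (ψ := ψ) (by simpa [ψ, hz] using h0)
      (fun a b => ?_) (fun a => hφ _) hv hv1).trans ih')
    · refine lintegral_congr fun x => ?_
      congr 1
      funext n
      rw [sum_box_succ, card_box, pow_succ]
      simp only [v, card_box, div_eq_mul_inv, Nat.cast_mul, ← Finset.sum_mul]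
      rw [ENNReal.mul_inv (.inr (ENNReal.natCast_ne_top _)) (.inl (ENNReal.natCast_ne_top _)), ← mul_assoc]
      congr 2
      refine Finset.sum_congr rfl fun a _ => Finset.sum_congr rfl fun l _ => ?_
      rw [hcons a l, hadd]
      rfl
    · simp only [ψ, ← hadd]; congr 1
      funext i; refine Fin.cases ?_ (fun i => ?_) i <;> simp

/-! ### Compactness: local rules and reconstruction -/

section

variable {d : ℕ} {A A₁ A₂ B : Type*}

@[simp]
theorem shift_apply (k l : Fin d → ℤ) (x : Config d A) : shift k x l = x (k + l) := rfl

theorem shift_shift (k l : Fin d → ℤ) (x : Config d A) :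
    shift k (shift l x) = shift (k + l) x := by
  funext m; simp [add_left_comm, add_assoc]

@[simp]
theorem shift_zero (x : Config d A) : shift 0 x = x := by
  funext m; simp

theorem LocalRule.toMap_shift (T : LocalRule d A₁ A₂) (k : Fin d → ℤ) (x : Config d A₁) :
    T.toMap (shift k x) = shift k (T.toMap x) := by
  funext l; simp [LocalRule.toMap, add_assoc]

theorem LocalRule.toMap_congr (T : LocalRule d A₁ A₂) {x y : Config d A₁} {k : Fin d → ℤ}
    (h : ∀ j ∈ T.window, x (k + j) = y (k + j)) : T.toMap x k = T.toMap y k := by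
  simp only [LocalRule.toMap]
  congr 1
  funext j
  exact h j j.2

theorem isClopen_occursAt [TopologicalSpace A] [DiscreteTopology A] (w : Pattern d A)
    (k : Fin d → ℤ) : IsClopen {x | w.OccursAt x k} := by
  have : {x | w.OccursAt x k} = ⋂ i : w.window, (fun x : Config d A => x (k + i)) ⁻¹'
      {w.letter i} := by
    ext x; simp [Pattern.OccursAt]
  rw [this]
  exact isClopen_iInter_of_finite fun i => (isClopen_discrete _).preimage (continuous_apply _)

theorem isClosed_locallyAdmissibleOn [TopologicalSpace A] [DiscreteTopology A]
    (F : Set (Pattern d A)) (S : Finset (Fin d → ℤ)) :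
    IsClosed {x | LocallyAdmissibleOn F x S} := by
  have : {x | LocallyAdmissibleOn F x S} =
      ⋂ w ∈ F, ⋂ k, ⋂ _ : ∀ i ∈ w.window, k + i ∈ S, {x | w.OccursAt x k}ᶜ := by
    ext x; simp [LocallyAdmissibleOn]
  rw [this]
  exact isClosed_biInter fun w _ => isClosed_iInter fun k => isClosed_iInter fun _ =>
    (isClopen_occursAt w k).compl.isClosed

theorem isClosed_sft [TopologicalSpace A] [DiscreteTopology A] (F : Set (Pattern d A)) :
    IsClosed (sft F) := by
  have : sft F = ⋂ w ∈ F, ⋂ k, {x | w.OccursAt x k}ᶜ := by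
    ext x; simp [sft]
  rw [this]
  exact isClosed_biInter fun w _ => isClosed_iInter fun k =>
    (isClopen_occursAt w k).compl.isClosed

theorem isOpen_globallyAdmissibleOn [TopologicalSpace A] [DiscreteTopology A]
    (F : Set (Pattern d A)) (S : Finset (Fin d → ℤ)) :
    IsOpen {x | GloballyAdmissibleOn F x S} := by
  have : {x | GloballyAdmissibleOn F x S} =
      ⋃ y ∈ sft F, ⋂ i ∈ S, (fun x : Config d A => x i) ⁻¹' {y i} := by
    ext x; simp [GloballyAdmissibleOn, eq_comm]
  rw [this]
  exact isOpen_biUnion fun y _ => isOpen_biInter_finset fun i _ =>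
    (isOpen_discrete _).preimage (continuous_apply _)

theorem LocallyAdmissibleOn.mono {F : Set (Pattern d A)} {x : Config d A}
    {S S' : Finset (Fin d → ℤ)} (h : LocallyAdmissibleOn F x S') (hS : S ⊆ S') :
    LocallyAdmissibleOn F x S :=
  fun w hw k hk => h w hw k fun i hi => hS (hk i hi)

theorem box_mono {m n : ℕ} (h : m ≤ n) : box d m ⊆ box d n :=
  fun _ hk => mem_box.2 fun i => (mem_box.1 hk i).trans h

theorem subset_box_maxNorm (W : Finset (Fin d → ℤ)) : W ⊆ box d (maxNorm W) :=
  fun c hc => mem_box.2 fun i =>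
    (Finset.le_sup (f := fun i => (c i).natAbs) (Finset.mem_univ i)).trans
      (Finset.le_sup (f := fun c : Fin d → ℤ => Finset.univ.sup fun i => (c i).natAbs) hc)

/-- By compactness, some radius suffices for reconstruction on `S`, so that the infimum defining
`reconstruction` is attained. -/
theorem exists_locallyAdmissibleOn_imp [Finite A] (F : Set (Pattern d A)) (hF : (sft F).Nonempty)
    (S : Finset (Fin d → ℤ)) : ∃ k : ℕ, ∀ x : Config d A, LocallyAdmissibleOn F x (S + box d k) →
      GloballyAdmissibleOn F x S := by
  rcases S.eq_empty_or_nonempty with rfl | ⟨s, hs⟩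
  · -- Here `S + B_k` is empty for all `k`, and only the existence of `y` is needed.
    obtain ⟨y, hy⟩ := hF
    exact ⟨0, fun x _ => ⟨y, hy, by simp⟩⟩
  let _ : TopologicalSpace A := ⊥
  have : DiscreteTopology A := ⟨rfl⟩
  obtain ⟨k, hk⟩ := (isOpen_globallyAdmissibleOn F S).isClosed_compl.isCompact
    |>.elim_directed_family_closed
      (fun k : ℕ => {x | LocallyAdmissibleOn F x (S + box d k)})
      (fun k => isClosed_locallyAdmissibleOn F _)
      (by
        refine Set.eq_empty_of_forall_notMem fun x ⟨hx, hx'⟩ => hx ⟨x, ?_, fun _ _ => rfl⟩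
        intro w hw k
        have hn := subset_box_maxNorm (w.window.image fun i => k + i - s)
        refine Set.mem_iInter.1 hx' (maxNorm (w.window.image fun i => k + i - s)) w hw k fun i hi => ?_
        have := Finset.add_mem_add hs (hn (Finset.mem_image_of_mem _ hi))
        simpa using this)
      (directed_of_isDirected_le fun m n h x hx =>
        LocallyAdmissibleOn.mono hx (Finset.add_subset_add_left (box_mono h)))
  refine ⟨k, fun x hx => by_contra fun hx' => ?_⟩
  exact Set.notMem_empty x (hk ▸ ⟨hx', hx⟩)

theorem globallyAdmissibleOn_of_locallyAdmissibleOn [Finite A] {F : Set (Pattern d A)}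
    (hF : (sft F).Nonempty) {S : Finset (Fin d → ℤ)} {x : Config d A}
    (hx : LocallyAdmissibleOn F x (S + box d (reconstruction F S))) :
    GloballyAdmissibleOn F x S :=
  Nat.sInf_mem (exists_locallyAdmissibleOn_imp F hF S) x hx

/-- A continuous function on a closed set of configurations, with discrete values, is determined
by finitely many cells. -/
theorem exists_window_of_continuous [Finite A] [TopologicalSpace A] [DiscreteTopology A]
    [TopologicalSpace B] [DiscreteTopology B] {K : Set (Config d A)} (hK : IsClosed K)
    {h : K → B} (hh : Continuous h) :
    ∃ J : Finset (Fin d → ℤ), ∀ x y : K, (∀ j ∈ J, x.1 j = y.1 j) → h x = h y := by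
  have : CompactSpace K := isCompact_iff_compactSpace.1 hK.isCompact
  have hs : IsClosed {p : K × K | h p.1 ≠ h p.2} := by
    have : Continuous fun p : K × K => (h p.1, h p.2) := by fun_prop
    exact (isClosed_discrete {q : B × B | q.1 ≠ q.2}).preimage this
  obtain ⟨J, hJ⟩ := hs.isCompact.elim_finite_subfamily_closed
    (fun j : Fin d → ℤ => {p : K × K | p.1.1 j = p.2.1 j})
    (fun j => isClosed_eq ((continuous_apply j).comp (continuous_subtype_val.comp continuous_fst))
      ((continuous_apply j).comp (continuous_subtype_val.comp continuous_snd)))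
    (by
      refine Set.eq_empty_of_forall_notMem fun p ⟨hp, hp'⟩ => hp ?_
      have : p.1 = p.2 := Subtype.ext (funext fun j => Set.mem_iInter.1 hp' j)
      rw [this])
  refine ⟨J, fun x y hxy => by_contra fun hne => ?_⟩
  refine Set.notMem_empty (x, y) (hJ ▸ ⟨hne, ?_⟩)
  simpa using hxy

/-- The Curtis–Hedlund–Lyndon theorem for a shift-commuting map between subshifts. -/
theorem exists_localRule_defines [Finite A₁] [TopologicalSpace A₁] [DiscreteTopology A₁]
    [TopologicalSpace A₂] [DiscreteTopology A₂] {F : Set (Pattern d A₁)} {G : Set (Pattern d A₂)}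
    (hF : (sft F).Nonempty) {θ : sft F → sft G} (hθ : Continuous θ)
    (hθs : ∀ (k : Fin d → ℤ) (x : sft F),
      (θ ⟨shift k x, shift_mem_sft x.2 k⟩ : Config d A₂) = shift k (θ x)) :
    ∃ T : LocalRule d A₁ A₂, T.Defines θ := by
  classical
  obtain ⟨x₀, hx₀⟩ := hF
  obtain ⟨J, hJ⟩ := exists_window_of_continuous (isClosed_sft F)
    (h := fun x => (θ x).1 0)
    ((continuous_apply 0).comp (continuous_subtype_val.comp hθ))
  refine ⟨⟨J, fun p => if h : ∃ x : sft F, ∀ j : J, x.1 j = p j then (θ h.choose).1 0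
    else (θ ⟨x₀, hx₀⟩).1 0⟩, fun x => funext fun k => ?_⟩
  have hex : ∃ y : sft F, ∀ j : J, y.1 j = x.1 (k + j) :=
    ⟨⟨shift k x, shift_mem_sft x.2 k⟩, fun j => rfl⟩
  simp only [LocalRule.toMap, dif_pos hex]
  rw [hJ hex.choose ⟨shift k x, shift_mem_sft x.2 k⟩ fun j hj => hex.choose_spec ⟨j, hj⟩, hθs]
  simp

theorem IsConjugacy.continuous_symm [Finite A₁] [TopologicalSpace A₁] [DiscreteTopology A₁]
    [TopologicalSpace A₂] [DiscreteTopology A₂] {F : Set (Pattern d A₁)} {G : Set (Pattern d A₂)}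
    {θ : sft F ≃ sft G} (hθ : IsConjugacy θ) : Continuous θ.symm := by
  have : CompactSpace (sft F) := isCompact_iff_compactSpace.1 (isClosed_sft F).isCompact
  exact (Continuous.homeoOfEquivCompactToT2 (f := θ) hθ.1).symm.continuous

theorem IsConjugacy.symm_shift [TopologicalSpace A₁] [TopologicalSpace A₂]
    {F : Set (Pattern d A₁)} {G : Set (Pattern d A₂)} {θ : sft F ≃ sft G} (hθ : IsConjugacy θ)
    (k : Fin d → ℤ) (y : sft G) :
    (θ.symm ⟨shift k y, shift_mem_sft y.2 k⟩ : Config d A₁) = shift k (θ.symm y) := by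
  have : θ.symm ⟨shift k y, shift_mem_sft y.2 k⟩ =
      ⟨shift k (θ.symm y), shift_mem_sft (θ.symm y).2 k⟩ := by
    rw [Equiv.symm_apply_eq]
    ext1
    rw [hθ.2, Equiv.apply_symm_apply]
  rw [this]

end

/-! ### Gluing a coupling along a map -/

section Glue

open ProbabilityTheory

theorem compProd_comap_map {α β γ : Type*} [MeasurableSpace α] [MeasurableSpace β]
    [MeasurableSpace γ] {μ : Measure α} [IsFiniteMeasure μ] {g : α → β} (hg : Measurable g)
    (K : Kernel β γ) [IsMarkovKernel K] :
    (μ.compProd (K.comap g hg)).map (Prod.map g id) = (μ.map g).compProd K := by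
  ext s hs
  rw [Measure.map_apply (hg.prodMap measurable_id) hs,
    Measure.compProd_apply (hg.prodMap measurable_id hs), Measure.compProd_apply hs,
    lintegral_map (Kernel.measurable_kernel_prodMk_left hs) hg]
  rfl

theorem compProd_map_prodMap {α γ : Type*} [MeasurableSpace α] [MeasurableSpace γ] {μ : Measure α} [IsFiniteMeasure μ] {S : γ → γ}
    (hS : Measurable S) (K : Kernel α γ) [IsMarkovKernel K] :
    (μ.compProd K).map (Prod.map id S) = μ.compProd (K.map S) := by
  have := Kernel.IsMarkovKernel.map K hS
  ext s hs
  rw [Measure.map_apply (measurable_id.prodMap hS) hs,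
    Measure.compProd_apply (measurable_id.prodMap hS hs), Measure.compProd_apply hs]
  refine lintegral_congr fun x => ?_
  rw [Kernel.map_apply' _ hS _ (measurable_prodMk_left hs)]
  rfl

/-- The law of `(x, y)` where `x` has law `μ` and, given `x`, the point `y` has the conditional law
of the second coordinate of `κ` given that the first is `g x`. -/
noncomputable def glue {α β γ : Type*} [MeasurableSpace α] [MeasurableSpace β]
    [MeasurableSpace γ] [StandardBorelSpace γ] [Nonempty γ] (μ : Measure α) (g : α → β)
    (hg : Measurable g) (κ : Measure (β × γ)) [IsFiniteMeasure κ] : Measure (α × γ) :=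
  μ.compProd (κ.condKernel.comap g hg)

variable {α β γ : Type*} [MeasurableSpace α] [MeasurableSpace β]
  [MeasurableSpace γ] [StandardBorelSpace γ] [Nonempty γ] {μ : Measure α} [IsProbabilityMeasure μ]
  {g : α → β} {hg : Measurable g} {κ : Measure (β × γ)} [IsFiniteMeasure κ]

instance : IsProbabilityMeasure (glue μ g hg κ) := by
  unfold glue; infer_instance

theorem glue_map_fst : (glue μ g hg κ).map Prod.fst = μ := by
  unfold glue; exact Measure.fst_compProd _ _

theorem glue_map (h : κ.map Prod.fst = μ.map g) : (glue μ g hg κ).map (Prod.map g id) = κ := by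
  rw [glue, compProd_comap_map hg, ← h]
  exact κ.disintegrate _

/-- The gluing is invariant: by uniqueness of disintegrations, the conditional law at `Sβ z` is the
image under `Sγ` of the conditional law at `z`. -/
theorem glue_map_prodMap (h : κ.map Prod.fst = μ.map g) {Sα : α → α} (Sβ : β ≃ᵐ β) {Sγ : γ → γ}
    (hSα : Measurable Sα) (hSγ : Measurable Sγ) (hμ : μ.map Sα = μ)
    (hκ : κ.map (Prod.map Sβ Sγ) = κ) (hgS : ∀ x, g (Sα x) = Sβ (g x)) :
    (glue μ g hg κ).map (Prod.map Sα Sγ) = glue μ g hg κ := by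
  set K := κ.condKernel with hK
  set μ' := μ.map g with hμ'
  have : IsProbabilityMeasure μ' := Measure.isProbabilityMeasure_map hg.aemeasurable
  have hdis : μ'.compProd K = κ := by rw [← h]; exact κ.disintegrate _
  have hmark := Kernel.IsMarkovKernel.map K hSγ
  have hμ'S : μ'.map Sβ = μ' := by
    rw [hμ', Measure.map_map Sβ.measurable hg]
    have : Sβ ∘ g = g ∘ Sα := funext fun x => (hgS x).symm
    rw [this, ← Measure.map_map hg hSα, hμ]
  have hcomp : μ'.compProd (K.map Sγ) = μ'.compProd (K.comap Sβ Sβ.measurable) := by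
    have h1 : (μ'.compProd (K.map Sγ)).map (Prod.map Sβ id) = κ := by
      rw [← compProd_map_prodMap hSγ, hdis,
        Measure.map_map (Sβ.measurable.prodMap measurable_id) (measurable_id.prodMap hSγ),
        Prod.map_comp_map]
      exact hκ
    have h2 : (μ'.compProd (K.comap Sβ Sβ.measurable)).map (Prod.map Sβ id) = κ := by
      rw [compProd_comap_map, hμ'S, hdis]
    exact (MeasurableEquiv.prodCongr Sβ (MeasurableEquiv.refl γ)).map_measurableEquiv_injective
      (h1.trans h2.symm)
  have hae : ∀ᵐ x ∂μ, K.map Sγ (g x) = K (Sβ (g x)) := by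
    have := Kernel.ae_eq_of_compProd_eq hcomp
    exact ae_of_ae_map hg.aemeasurable this
  calc (glue μ g hg κ).map (Prod.map Sα Sγ)
      = ((glue μ g hg κ).map (Prod.map id Sγ)).map (Prod.map Sα id) := by
        rw [Measure.map_map (hSα.prodMap measurable_id) (measurable_id.prodMap hSγ),
          Prod.map_comp_map]
        rfl
    _ = (μ.compProd ((K.comap g hg).map Sγ)).map (Prod.map Sα id) := by
        rw [glue, compProd_map_prodMap hSγ]
    _ = (μ.compProd ((K.comap g hg).comap Sα hSα)).map (Prod.map Sα id) := by
        congr 1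
        have := Kernel.IsMarkovKernel.map (K.comap g hg) hSγ
        refine Measure.compProd_congr ?_
        filter_upwards [hae] with x hx
        rw [Kernel.map_apply _ hSγ, Kernel.comap_apply, Kernel.comap_apply, Kernel.comap_apply, hgS,
          ← hx, Kernel.map_apply _ hSγ]
    _ = glue μ g hg κ := by
        rw [compProd_comap_map hSα, hμ]
        rfl

end Glue

section

variable {d : ℕ} {A A₁ A₂ B : Type*}

/-! ### Invariant measures -/

/-- The configuration over the product alphabet with the two given layers. -/
def zip (x : Config d A) (y : Config d B) : Config d (A × B) := fun k => (x k, y k)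

@[simp]
theorem shift_zip (k : Fin d → ℤ) (x : Config d A) (y : Config d B) :
    zip (shift k x) (shift k y) = shift k (zip x y) := rfl

theorem proj₁_shift (k : Fin d → ℤ) (z : Config d (A × B)) :
    proj₁ (shift k z) = shift k (proj₁ z) := rfl

theorem proj₂_shift (k : Fin d → ℤ) (z : Config d (A × B)) :
    proj₂ (shift k z) = shift k (proj₂ z) := rfl

theorem thicken_shift (n : ℕ) (k : Fin d → ℤ) (b : Config d Bool) :
    thicken n (shift k b) = shift k (thicken n b) := by
  funext l; simp [thicken, add_assoc]

theorem thicken_eq_true {n : ℕ} {b : Config d Bool} {k : Fin d → ℤ} :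
    thicken n b k = true ↔ ∃ j ∈ box d n, b (k + j) = true := by
  rw [thicken, ← not_iff_not, Bool.not_eq_true]
  exact (Finset.sup_eq_bot_iff _ _).trans (by simp [show (⊥ : Bool) = false from rfl])

theorem measurable_shift [MeasurableSpace A] (k : Fin d → ℤ) :
    Measurable (shift k : Config d A → Config d A) :=
  measurable_pi_lambda _ fun l => measurable_pi_apply (k + l)

theorem measurable_proj₁ [MeasurableSpace A] [MeasurableSpace B] :
    Measurable (proj₁ : Config d (A × B) → Config d A) :=
  measurable_pi_lambda _ fun k => measurable_fst.comp (measurable_pi_apply k)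

theorem measurable_proj₂ [MeasurableSpace A] [MeasurableSpace B] :
    Measurable (proj₂ : Config d (A × B) → Config d B) :=
  measurable_pi_lambda _ fun k => measurable_snd.comp (measurable_pi_apply k)

theorem measurable_zip [MeasurableSpace A] [MeasurableSpace B] {Ω : Type*} [MeasurableSpace Ω]
    {f : Ω → Config d A} {g : Ω → Config d B} (hf : Measurable f) (hg : Measurable g) :
    Measurable fun ω => zip (f ω) (g ω) :=
  measurable_pi_lambda _ fun k =>
    ((measurable_pi_apply k).comp hf).prodMk ((measurable_pi_apply k).comp hg)

theorem LocalRule.measurable_toMap [Finite A₁] [MeasurableSpace A₁] [DiscreteMeasurableSpace A₁]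
    [MeasurableSpace A₂] (T : LocalRule d A₁ A₂) : Measurable T.toMap := by
  refine measurable_pi_lambda _ fun k => ?_
  exact (measurable_of_finite T.rule).comp
    (measurable_pi_lambda _ fun j => measurable_pi_apply (k + j))

theorem measurable_thicken (n : ℕ) : Measurable (thicken n : Config d Bool → Config d Bool) := by
  refine measurable_pi_lambda _ fun k => measurable_to_bool ?_
  have : (fun b : Config d Bool => thicken n b k) ⁻¹' {true} =
      ⋃ j ∈ box d n, (fun b : Config d Bool => b (k + j)) ⁻¹' {true} := by
    ext b; simp [thicken_eq_true]
  rw [this]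
  exact Finset.measurableSet_biUnion _ fun j _ =>
    measurable_pi_apply _ (MeasurableSet.of_discrete)

theorem measurableSet_sft [MeasurableSpace A] [DiscreteMeasurableSpace A]
    {F : Set (Pattern d A)} (hF : F.Countable) : MeasurableSet (sft F) := by
  have : sft F = ⋂ w ∈ F, ⋂ k, (⋂ i : w.window, (fun x : Config d A => x (k + i)) ⁻¹'
      {w.letter i})ᶜ := by
    ext x; simp [sft, Pattern.OccursAt]
  rw [this]
  exact MeasurableSet.biInter hF fun w _ => MeasurableSet.iInter fun k =>
    (MeasurableSet.iInter fun i => measurable_pi_apply _ (MeasurableSet.of_discrete)).compl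

theorem map_mem_invMeasures [MeasurableSpace A] [MeasurableSpace B] {μ : Measure (Config d A)}
    (hμ : μ ∈ invMeasures d A) {Φ : Config d A → Config d B} (hΦ : Measurable Φ)
    (hs : ∀ k x, Φ (shift k x) = shift k (Φ x)) : μ.map Φ ∈ invMeasures d B := by
  have := hμ.1
  refine ⟨Measure.isProbabilityMeasure_map hΦ.aemeasurable, fun k => ?_⟩
  rw [Measure.map_map (measurable_shift k) hΦ]
  have : shift k ∘ Φ = Φ ∘ shift k := funext fun x => (hs k x).symm
  rw [this, ← Measure.map_map hΦ (measurable_shift k), hμ.2 k]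

theorem measure_cell_eq [MeasurableSpace A] {μ : Measure (Config d A)}
    (hμ : μ ∈ invMeasures d A) {P : Set A} (hP : MeasurableSet P) (k : Fin d → ℤ) :
    μ {x | x k ∈ P} = μ {x | x 0 ∈ P} := by
  conv_rhs => rw [← hμ.2 k]
  have hm : MeasurableSet {x : Config d A | x 0 ∈ P} := measurable_pi_apply 0 hP
  rw [Measure.map_apply (measurable_shift k) hm]
  congr 1
  ext x
  simp

/-- For an invariant coupling, the mean Hamming–Besicovitch distance is the probability that the
two layers differ at the origin: one inequality is the ergodic inequality, the other is the
reverse Fatou lemma. -/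
theorem lintegral_hammingBesicovitch [Finite A] [MeasurableSpace A] [DiscreteMeasurableSpace A]
    {l : Measure (Config d (A × A))} (hl : l ∈ invMeasures d (A × A)) :
    ∫⁻ z, hammingBesicovitch (proj₁ z) (proj₂ z) ∂l = l {z | (z 0).1 ≠ (z 0).2} := by
  classical
  have := hl.1
  set D : Set (Config d (A × A)) := {z | (z 0).1 ≠ (z 0).2}
  have hcell : ∀ k, MeasurableSet {z : Config d (A × A) | (z k).1 ≠ (z k).2} := fun k =>
    (measurable_pi_apply k : Measurable fun z : Config d (A × A) => z k)
      (MeasurableSet.of_discrete (s := {p : A × A | p.1 ≠ p.2}))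
  set u : Config d (A × A) → ℝ≥0∞ := D.indicator 1
  have hu : Measurable u := measurable_one.indicator (hcell 0)
  have hu1 : ∀ z, u z ≤ 1 := fun z => Set.indicator_le_self' (fun _ _ => zero_le) z
  have hint : ∫⁻ z, u z ∂l = l D := lintegral_indicator_one (hcell 0)
  have hmp : ∀ k : Fin d → ℤ, MeasurePreserving (shift k) l l := fun k =>
    ⟨measurable_shift k, hl.2 k⟩
  have hcard : ∀ n z, ((((box d n).filter fun k => proj₁ z k ≠ proj₂ z k).card : ℕ) : ℝ≥0∞) =
      ∑ k ∈ box d n, u (shift k z) := fun n z => by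
    rw [Finset.card_filter, Nat.cast_sum]
    refine Finset.sum_congr rfl fun k _ => ?_
    by_cases h : (z k).1 = (z k).2 <;> simp [u, D, proj₁, proj₂, h]
  have heq : ∀ z, hammingBesicovitch (proj₁ z) (proj₂ z) = limsup (fun n : ℕ =>
      (∑ k ∈ box d n, u (shift k z)) / ((box d n).card : ℝ≥0∞)) atTop := fun z => by
    simp only [hammingBesicovitch, ← hcard]
  simp_rw [heq]
  refine le_antisymm ?_ ?_
  · rw [← hint]
    exact lintegral_limsup_avg_box_le d (funext shift_zero)
      (fun a b => funext fun x => (shift_shift a b x).symm) hmp hu hu1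
  · have hm : ∀ n, Measurable fun z =>
        (∑ k ∈ box d n, u (shift k z)) / ((box d n).card : ℝ≥0∞) := fun n =>
      (Finset.measurable_sum _ fun k _ => hu.comp (measurable_shift k)).div_const _
    have hc0 : ∀ n, ((box d n).card : ℝ≥0∞) ≠ 0 := fun n => by simp [card_box]
    have hrev := limsup_lintegral_le (μ := l) (fun _ => 1) hm
      (fun n => Eventually.of_forall fun z => ENNReal.div_le_of_le_mul
        ((Finset.sum_le_sum fun k _ => hu1 _).trans (by simp))) (by simp)
    refine le_trans (le_of_eq ?_) hrev
    have : ∀ n, ∫⁻ z, (∑ k ∈ box d n, u (shift k z)) / ((box d n).card : ℝ≥0∞) ∂l = l D :=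
      fun n => by
        simp only [div_eq_mul_inv]
        rw [lintegral_mul_const' _ _ (ENNReal.inv_ne_top.2 (hc0 n)),
          lintegral_finsetSum _ fun k _ => by exact hu.comp (measurable_shift k)]
        simp only [(hmp _).lintegral_comp hu, hint, Finset.sum_const, nsmul_eq_mul]
        rw [mul_comm, ← mul_assoc, ENNReal.inv_mul_cancel (hc0 n) (by simp), one_mul]
    simp only [this, limsup_const]

theorem besicovitchDist_eq [Finite A] [MeasurableSpace A] [DiscreteMeasurableSpace A]
    (μ ν : Measure (Config d A)) :
    besicovitchDist μ ν = ⨅ l ∈ couplings μ ν, l {z | (z 0).1 ≠ (z 0).2} :=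
  iInf_congr fun _ => iInf_congr fun hl => lintegral_hammingBesicovitch hl.1

/-! ### Transport of couplings by a local rule -/

/-- The shift by `k` as a measurable equivalence. -/
def shiftEquiv [MeasurableSpace A] (k : Fin d → ℤ) : Config d A ≃ᵐ Config d A where
  toFun := shift k
  invFun := shift (-k)
  left_inv x := by rw [shift_shift]; simp
  right_inv x := by rw [shift_shift]; simp
  measurable_toFun := measurable_shift k
  measurable_invFun := measurable_shift (-k)

/-- Given a coupling of the image of `μ` under `T'` with `ν`, there is a coupling of `μ` with the
image of `ν` under `T`; its disagreement at the origin comes from the error of `T ∘ T'` and from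
the disagreements of the given coupling on the window of `T`. -/
theorem exists_coupling_map [Finite A₁] [MeasurableSpace A₁] [DiscreteMeasurableSpace A₁]
    [Nonempty A₁] [Finite A₂] [MeasurableSpace A₂] [DiscreteMeasurableSpace A₂]
    (T : LocalRule d A₁ A₂) (T' : LocalRule d A₂ A₁)
    {μ : Measure (Config d A₂)} (hμ : μ ∈ invMeasures d A₂) {ν : Measure (Config d A₁)}
    {κ : Measure (Config d (A₁ × A₁))} (hκ : κ ∈ couplings (μ.map T'.toMap) ν) :
    ∃ l ∈ couplings μ (ν.map T.toMap), l {z | (z 0).1 ≠ (z 0).2} ≤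
      μ {x | T.toMap (T'.toMap x) 0 ≠ x 0} + T.constD * κ {z | (z 0).1 ≠ (z 0).2} := by
  obtain ⟨hκinv, hκ1, hκ2⟩ := hκ
  have := hμ.1
  have := hκinv.1
  have hT' : Measurable T'.toMap := T'.measurable_toMap
  have hT : Measurable T.toMap := T.measurable_toMap
  set unzip : Config d (A₁ × A₁) → Config d A₁ × Config d A₁ := fun z => (proj₁ z, proj₂ z)
  have hunzip : Measurable unzip := measurable_proj₁.prodMk measurable_proj₂
  set κ' := κ.map unzip with hκ'
  have : IsProbabilityMeasure κ' := Measure.isProbabilityMeasure_map hunzip.aemeasurable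
  have hfst : κ'.map Prod.fst = μ.map T'.toMap := by
    rw [hκ', Measure.map_map measurable_fst hunzip, ← hκ1]; rfl
  have hsnd : κ'.map Prod.snd = ν := by
    rw [hκ', Measure.map_map measurable_snd hunzip, ← hκ2]; rfl
  -- `ρ` is the joint law of `(x, y)` for which `(T' x, y)` has law `κ`.
  set ρ := glue μ T'.toMap hT' κ'
  have hρ : ρ.map (Prod.map T'.toMap id) = κ' := glue_map hfst
  have hρinv : ∀ k, ρ.map (Prod.map (shift k) (shift k)) = ρ := fun k => by
    refine glue_map_prodMap hfst (shiftEquiv k) (measurable_shift k) (measurable_shift k)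
      (hμ.2 k) ?_ fun x => T'.toMap_shift k x
    have hs : Measurable (Prod.map (shift k) (shift k) :
        Config d A₁ × Config d A₁ → Config d A₁ × Config d A₁) :=
      (measurable_shift k).prodMap (measurable_shift k)
    change κ'.map (Prod.map (shift k) (shift k)) = κ'
    rw [hκ', Measure.map_map hs hunzip]
    have : Prod.map (shift k) (shift k) ∘ unzip = unzip ∘ shift k := rfl
    rw [this, ← Measure.map_map hunzip (measurable_shift k), hκinv.2 k]
  set Φ : Config d A₂ × Config d A₁ → Config d (A₂ × A₂) := fun p => zip p.1 (T.toMap p.2)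
  have hΦ : Measurable Φ := measurable_zip measurable_fst (hT.comp measurable_snd)
  refine ⟨ρ.map Φ, ⟨⟨Measure.isProbabilityMeasure_map hΦ.aemeasurable, fun k => ?_⟩, ?_, ?_⟩, ?_⟩
  · rw [Measure.map_map (measurable_shift k) hΦ]
    have : shift k ∘ Φ = Φ ∘ Prod.map (shift k) (shift k) := funext fun p => by
      simp [Φ, T.toMap_shift]
    rw [this, ← Measure.map_map hΦ ((measurable_shift k).prodMap (measurable_shift k)), hρinv k]
  · rw [Measure.map_map measurable_proj₁ hΦ]
    exact glue_map_fst
  · rw [Measure.map_map measurable_proj₂ hΦ, ← hsnd, ← hρ,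
      Measure.map_map measurable_snd (hT'.prodMap measurable_id),
      Measure.map_map hT (measurable_snd.comp (hT'.prodMap measurable_id))]
    rfl
  · have hne : MeasurableSet {p : A₂ × A₂ | p.1 ≠ p.2} := MeasurableSet.of_discrete
    have hm₀ : MeasurableSet {z : Config d (A₂ × A₂) | (z 0).1 ≠ (z 0).2} :=
      (measurable_pi_apply 0 : Measurable fun z : Config d (A₂ × A₂) => z 0) hne
    rw [Measure.map_apply hΦ hm₀]
    -- If `x` agrees with `T (T' x)` at the origin and `T' x` with `y` on the window of `T`, then
    -- `x` agrees with `T y` at the origin.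
    have hsub : Φ ⁻¹' {z | (z 0).1 ≠ (z 0).2} ⊆
        Prod.fst ⁻¹' {x | T.toMap (T'.toMap x) 0 ≠ x 0} ∪
        ⋃ j ∈ T.window, Prod.map T'.toMap id ⁻¹' {q | q.1 j ≠ q.2 j} := by
      rintro ⟨x, y⟩ hxy
      by_contra hcon
      simp only [Set.mem_union, Set.mem_preimage, Set.mem_ofPred_eq, Set.mem_iUnion, not_or,
        not_not, not_exists, exists_prop, not_and, Prod.map_fst, Prod.map_snd, id_eq] at hcon
      refine hxy ?_
      change x 0 = T.toMap y 0
      rw [← hcon.1]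
      exact T.toMap_congr fun j hj => by simpa using hcon.2 j hj
    refine (measure_mono hsub).trans ((measure_union_le _ _).trans (add_le_add (le_of_eq ?_) ?_))
    · have hm : MeasurableSet {x : Config d A₂ | T.toMap (T'.toMap x) 0 ≠ x 0} :=
        (((measurable_pi_apply 0).comp (hT.comp hT')).prodMk (measurable_pi_apply 0))
          hne
      rw [← Measure.map_apply measurable_fst hm]
      rw [show ρ.map Prod.fst = μ from glue_map_fst]
    · refine (measure_biUnion_finset_le _ _).trans (le_of_eq ?_)
      have hne₁ : MeasurableSet {p : A₁ × A₁ | p.1 ≠ p.2} := MeasurableSet.of_discrete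
      have hj : ∀ j, ρ (Prod.map T'.toMap id ⁻¹' {q | q.1 j ≠ q.2 j}) =
          κ {z | (z 0).1 ≠ (z 0).2} := fun j => by
        have hm : MeasurableSet {q : Config d A₁ × Config d A₁ | q.1 j ≠ q.2 j} :=
          (((measurable_pi_apply j).comp measurable_fst).prodMk
            ((measurable_pi_apply j).comp measurable_snd) :
            Measurable fun q : Config d A₁ × Config d A₁ => (q.1 j, q.2 j)) hne₁
        rw [← Measure.map_apply (hT'.prodMap measurable_id) hm, hρ, hκ',
          Measure.map_apply hunzip hm]
        exact measure_cell_eq hκinv hne₁ j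
      simp only [hj, Finset.sum_const, nsmul_eq_mul, LocalRule.constD]

/-! ### Noise -/

/-- A noisy configuration without clear forbidden patterns is locally admissible wherever it is
not obscured. -/
theorem locallyAdmissibleOn_of_clear {G : Set (Pattern d A)} {z : Config d (A × Bool)}
    (hz : z ∈ sft (Pattern.clear '' G)) {S : Finset (Fin d → ℤ)} {k : Fin d → ℤ}
    (hb : ∀ i ∈ S, proj₂ z (k + i) = false) :
    LocallyAdmissibleOn G (shift k (proj₁ z)) S := by
  intro w hw l hl hocc
  refine hz w.clear ⟨w, hw, rfl⟩ (k + l) fun i => Prod.ext ?_ ?_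
  · have := hocc i
    simpa [add_assoc, proj₁, Pattern.clear] using this
  · have := hb (l + i) (hl i i.2)
    simpa [add_assoc, proj₂, Pattern.clear] using this

/-- Where a neighbourhood of the translate `k + S` of radius `φ_G(S)` is not obscured, a noisy
configuration coincides with a configuration of the subshift on `k + S`. -/
theorem exists_mem_sft_eqOn [Finite A] {G : Set (Pattern d A)} (hG : (sft G).Nonempty)
    {z : Config d (A × Bool)} (hz : z ∈ sft (Pattern.clear '' G)) {S : Finset (Fin d → ℤ)}
    {k : Fin d → ℤ} (hb : ∀ i ∈ S + box d (reconstruction G S), proj₂ z (k + i) = false) :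
    ∃ y ∈ sft G, ∀ i ∈ S, y (k + i) = proj₁ z (k + i) := by
  obtain ⟨y, hy, hyS⟩ :=
    globallyAdmissibleOn_of_locallyAdmissibleOn hG (locallyAdmissibleOn_of_clear hz hb)
  refine ⟨shift (-k) y, shift_mem_sft hy _, fun i hi => ?_⟩
  simpa using hyS i hi

/-- If `T ∘ T'` is the identity on `Ω_G`, its error at the origin only occurs when the noise obscures a cell close to it. -/
theorem toMap_toMap_eq [Finite A₂] {G : Set (Pattern d A₂)} (hG : (sft G).Nonempty)
    (T : LocalRule d A₁ A₂) (T' : LocalRule d A₂ A₁)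
    (hTT' : ∀ y ∈ sft G, T.toMap (T'.toMap y) = y)
    {z : Config d (A₂ × Bool)} (hz : z ∈ sft (Pattern.clear '' G)) {J : Finset (Fin d → ℤ)}
    (hJ : J = {0} ∪ (T'.window + T.window))
    (hb : ∀ i ∈ J + box d (reconstruction G J), proj₂ z i = false) :
    T.toMap (T'.toMap (proj₁ z)) 0 = proj₁ z 0 := by
  obtain ⟨y, hy, hyJ⟩ := exists_mem_sft_eqOn hG hz (S := J) (k := 0) (by simpa using hb)
  simp only [zero_add] at hyJ
  rw [← hyJ 0 (by simp [hJ])]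
  conv_rhs => rw [← hTT' y hy]
  refine T.toMap_congr fun j hj => T'.toMap_congr fun i hi => (hyJ _ ?_).symm
  rw [zero_add, add_comm, hJ]
  exact Finset.mem_union_right _ (Finset.add_mem_add hi hj)

/-- The error of `T ∘ T'` has probability at most `E ε`, by a union bound over the cells of
`J + B_{φ_G(J)}`. -/
theorem measure_toMap_toMap_ne_le [Finite A₁] [MeasurableSpace A₁] [DiscreteMeasurableSpace A₁]
    [Finite A₂] [MeasurableSpace A₂] [DiscreteMeasurableSpace A₂] {G : Finset (Pattern d A₂)}
    (hG : (sft (G : Set (Pattern d A₂))).Nonempty)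
    (T : LocalRule d A₁ A₂) (T' : LocalRule d A₂ A₁)
    (hTT' : ∀ y ∈ sft (G : Set (Pattern d A₂)), T.toMap (T'.toMap y) = y)
    {N : Set (Measure (Config d Bool))} {ε : I} {l : Measure (Config d (A₂ × Bool))}
    (hl : l ∈ noisyMeasures (G : Set (Pattern d A₂)) N ε) :
    l.map proj₁ {x | T.toMap (T'.toMap x) 0 ≠ x 0} ≤ constE T T' G * ENNReal.ofReal ε := by
  obtain ⟨⟨hinv, hsft⟩, -, hε⟩ := hl
  have hm : MeasurableSet {x : Config d A₂ | T.toMap (T'.toMap x) 0 ≠ x 0} :=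
    (((measurable_pi_apply 0).comp (T.measurable_toMap.comp T'.measurable_toMap)).prodMk
      (measurable_pi_apply 0) : Measurable fun x : Config d A₂ => (T.toMap (T'.toMap x) 0, x 0))
      (MeasurableSet.of_discrete (s := {p : A₂ × A₂ | p.1 ≠ p.2}))
  have hmb : MeasurableSet {b : Config d Bool | b 0 = true} :=
    (measurable_pi_apply 0 : Measurable fun b : Config d Bool => b 0)
      (MeasurableSet.of_discrete (s := {true}))
  rw [Measure.map_apply measurable_proj₂ hmb] at hε
  rw [Measure.map_apply measurable_proj₁ hm, constE]
  set J : Finset (Fin d → ℤ) := {0} ∪ (T'.window + T.window) with hJ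
  set S := J + box d (reconstruction (G : Set (Pattern d A₂)) J)
  have hsub : proj₁ ⁻¹' {x | T.toMap (T'.toMap x) 0 ≠ x 0} ≤ᵐ[l]
      (⋃ j ∈ S, {z | z j ∈ {p : A₂ × Bool | p.2 = true}} : Set (Config d (A₂ × Bool))) := by
    filter_upwards [hsft] with z hz hne
    by_contra hcon
    change z ∉ (⋃ j ∈ S, _ : Set _) at hcon
    simp only [Set.mem_iUnion, Set.mem_ofPred_eq, exists_prop, not_exists, not_and,
      Bool.not_eq_true] at hcon
    exact hne (toMap_toMap_eq hG T T' hTT' hz hJ hcon)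
  refine (measure_mono_ae hsub).trans ((measure_biUnion_finset_le _ _).trans ?_)
  simp only [measure_cell_eq hinv (MeasurableSet.of_discrete (s := {p : A₂ × Bool | p.2 = true}))]
  rw [Finset.sum_const, nsmul_eq_mul]
  gcongr
  exact hε

/-- The map on noisy configurations that applies a local rule and thickens the noise. -/
noncomputable def LocalRule.noisyMap (T' : LocalRule d A₂ A₁) (r : ℕ)
    (z : Config d (A₂ × Bool)) : Config d (A₁ × Bool) :=
  zip (T'.toMap (proj₁ z)) (thicken r (proj₂ z))

/-- If the thickened noise is clear on a translate of `I(w)`, the original noise is clear on a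
neighbourhood large enough for the reconstruction on the cells that determine `T'` there; so `T'`
agrees there with its value at a configuration of `Ω_G`, and `w` does not occur. -/
theorem LocalRule.noisyMap_mem_sft [Finite A₂] {F : Finset (Pattern d A₁)}
    {G : Finset (Pattern d A₂)} (hG : (sft (G : Set (Pattern d A₂))).Nonempty)
    (T' : LocalRule d A₂ A₁)
    (hT' : ∀ y ∈ sft (G : Set (Pattern d A₂)), T'.toMap y ∈ sft (F : Set (Pattern d A₁)))
    {z : Config d (A₂ × Bool)} (hz : z ∈ sft (Pattern.clear '' (G : Set (Pattern d A₂)))) :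
    T'.noisyMap (T'.radius G F) z ∈ sft (Pattern.clear '' (F : Set (Pattern d A₁))) := by
  rintro _ ⟨w, hw, rfl⟩ k hocc
  set r := T'.radius G F with hr
  have h2 : ∀ i ∈ w.window, ∀ j ∈ box d r, proj₂ z (k + i + j) = false := fun i hi j hj => by
    have := congrArg Prod.snd (hocc ⟨i, hi⟩)
    change thicken r (proj₂ z) (k + i) = false at this
    by_contra hne
    have htrue := thicken_eq_true.2 ⟨j, hj, Bool.eq_true_of_not_eq_false hne⟩
    rw [this] at htrue
    exact Bool.false_ne_true htrue
  set S := T'.window + w.window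
  have hrad : reconstruction (G : Set (Pattern d A₂)) S + maxNorm T'.window ≤ r := by
    rw [hr, LocalRule.radius]
    gcongr
    exact Finset.le_sup
      (f := fun w : Pattern d A₁ => reconstruction (G : Set (Pattern d A₂)) (T'.window + w.window))
      (Finset.mem_coe.1 hw)
  obtain ⟨y, hy, hyS⟩ := exists_mem_sft_eqOn hG hz (S := S) (k := k) (by
    intro i hi
    obtain ⟨s, hs, c, hc, rfl⟩ := Finset.mem_add.1 hi
    obtain ⟨a, ha, b, hb, rfl⟩ := Finset.mem_add.1 hs
    have hmem : a + c ∈ box d r := by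
      have ha' := mem_box.1 (subset_box_maxNorm _ ha)
      have hc' := mem_box.1 hc
      refine mem_box.2 fun m => ?_
      have h3 := ha' m
      have h4 := hc' m
      rw [Pi.add_apply]
      omega
    have := h2 b hb (a + c) hmem
    rwa [show k + (a + b + c) = k + b + (a + c) by abel])
  refine hT' y hy w hw k fun i => ?_
  have h5 : T'.toMap y (k + i) = T'.toMap (proj₁ z) (k + i) := T'.toMap_congr fun j hj => by
    have := hyS (j + i) (Finset.add_mem_add hj i.2)
    rwa [show k + i + j = k + (j + i) by abel]
  rw [shift_apply, h5]
  exact congrArg Prod.fst (hocc i)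

/-- A noisy measure for `Ω_G` with noise rate `ε` is sent to a noisy measure for `Ω_F` with noise
rate at most `min (C ε) 1`, by a union bound over the `C = (2 r + 1) ^ d` cells of `B_r`. -/
theorem LocalRule.map_noisyMap_mem [Finite A₁] [MeasurableSpace A₁] [DiscreteMeasurableSpace A₁]
    [Finite A₂] [MeasurableSpace A₂] [DiscreteMeasurableSpace A₂]
    {F : Finset (Pattern d A₁)} {G : Finset (Pattern d A₂)}
    (hG : (sft (G : Set (Pattern d A₂))).Nonempty) (T' : LocalRule d A₂ A₁)
    (hT' : ∀ y ∈ sft (G : Set (Pattern d A₂)), T'.toMap y ∈ sft (F : Set (Pattern d A₁)))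
    {N : Set (Measure (Config d Bool))} {ε : I} {l : Measure (Config d (A₂ × Bool))}
    (hl : l ∈ noisyMeasures (G : Set (Pattern d A₂)) N ε) :
    l.map (T'.noisyMap (T'.radius G F)) ∈ noisyMeasures (F : Set (Pattern d A₁))
      (thickenClass (T'.radius G F) N)
      (Set.projIcc 0 1 zero_le_one ((T'.constC G F : ℝ) * (ε : ℝ))) := by
  obtain ⟨⟨hinv, hsft⟩, hN, hε⟩ := hl
  have := hinv.1
  set r := T'.radius G F with hr
  have hm : Measurable (T'.noisyMap r) :=
    measurable_zip (T'.measurable_toMap.comp measurable_proj₁)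
      ((measurable_thicken r).comp measurable_proj₂)
  have hmb : ∀ j, MeasurableSet {b : Config d Bool | b j = true} := fun j =>
    (measurable_pi_apply j : Measurable fun b : Config d Bool => b j)
      (MeasurableSet.of_discrete (s := {true}))
  have hproj : (l.map (T'.noisyMap r)).map proj₂ = (l.map proj₂).map (thicken r) := by
    rw [Measure.map_map measurable_proj₂ hm, Measure.map_map (measurable_thicken r) measurable_proj₂]
    rfl
  have hminv := map_mem_invMeasures hinv hm fun k z => by
    simp only [LocalRule.noisyMap, proj₁_shift, proj₂_shift, T'.toMap_shift, thicken_shift,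
      shift_zip]
  refine ⟨⟨hminv, ?_⟩, ?_, ?_⟩
  · rw [ae_map_iff (p := (· ∈ sft (Pattern.clear '' (F : Set (Pattern d A₁))))) hm.aemeasurable
      (measurableSet_sft (F.countable_toSet.image _))]
    filter_upwards [hsft] with z hz using T'.noisyMap_mem_sft hG hT' hz
  · exact ⟨_, hN, hproj.symm⟩
  · have hbinv : l.map proj₂ ∈ invMeasures d Bool :=
      map_mem_invMeasures hinv measurable_proj₂ fun k z => proj₂_shift k z
    have hp1 : (l.map (T'.noisyMap r)).map proj₂ {b | b 0 = true} ≤ 1 := by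
      have := hminv.1
      have := Measure.isProbabilityMeasure_map (μ := l.map (T'.noisyMap r))
        (measurable_proj₂ (A := A₁) (B := Bool) (d := d)).aemeasurable
      exact prob_le_one
    have hpC : (l.map (T'.noisyMap r)).map proj₂ {b | b 0 = true} ≤
        ENNReal.ofReal ((T'.constC G F : ℝ) * (ε : ℝ)) := by
      rw [hproj, Measure.map_apply (measurable_thicken r) (hmb 0)]
      have hsub : thicken r ⁻¹' {b : Config d Bool | b 0 = true} ⊆
          ⋃ j ∈ box d r, {b | b j ∈ ({true} : Set Bool)} := fun b hb => by
        obtain ⟨j, hj, hbj⟩ := thicken_eq_true.1 (show thicken r b 0 = true from hb)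
        simp only [Set.mem_iUnion]
        exact ⟨j, hj, by simpa using hbj⟩
      refine (measure_mono hsub).trans ((measure_biUnion_finset_le _ _).trans ?_)
      simp only [measure_cell_eq hbinv (MeasurableSet.of_discrete (s := ({true} : Set Bool)))]
      rw [Finset.sum_const, nsmul_eq_mul, card_box, ENNReal.ofReal_mul (by positivity),
        ENNReal.ofReal_natCast, LocalRule.constC]
      gcongr
      exact hε
    rw [Set.coe_projIcc]
    rcases le_total ((T'.constC G F : ℝ) * (ε : ℝ)) 1 with h | h
    · rw [min_eq_right h, max_eq_right (mul_nonneg (Nat.cast_nonneg _) ε.2.1)]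
      exact hpC
    · rw [min_eq_left h]
      simpa using hp1

/-! ### Stability under conjugacy -/

theorem isSpeed_newSpeed {f : I → ℝ≥0} (hf : IsSpeed f) (D C E : ℕ) :
    IsSpeed (newSpeed D C E f) := by
  obtain ⟨hmono, h0, hcont⟩ := hf
  have hproj0 : Set.projIcc (0 : ℝ) 1 zero_le_one ((C : ℝ) * ((0 : I) : ℝ)) = 0 := by
    simp
  refine ⟨fun a b hab => ?_, ?_, ?_⟩
  · have hab' : (a : ℝ) ≤ b := hab
    unfold newSpeed
    gcongr
    exact hmono (Set.monotone_projIcc _ (by gcongr))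
  · unfold newSpeed
    rw [hproj0, h0]
    simp
  · unfold newSpeed
    have hp : Continuous fun ε : I =>
        Set.projIcc (0 : ℝ) 1 zero_le_one ((C : ℝ) * (ε : ℝ)) :=
      continuous_projIcc.comp (by fun_prop)
    have hfp : ContinuousAt (fun ε : I =>
        f (Set.projIcc (0 : ℝ) 1 zero_le_one ((C : ℝ) * (ε : ℝ)))) 0 :=
      ContinuousAt.comp (g := f) (by rw [hproj0]; exact hcont) hp.continuousAt
    have ht : ContinuousAt (fun ε : I => Real.toNNReal (ε : ℝ)) 0 := by fun_prop
    exact (continuousAt_const.mul hfp).add (continuousAt_const.mul ht)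

theorem LocalRule.map_toMap_mem_sftMeasures [Finite A₁] [MeasurableSpace A₁]
    [DiscreteMeasurableSpace A₁] [MeasurableSpace A₂] [DiscreteMeasurableSpace A₂]
    {F : Set (Pattern d A₁)} {G : Set (Pattern d A₂)} (hG : G.Countable) (T : LocalRule d A₁ A₂)
    (hT : ∀ x ∈ sft F, T.toMap x ∈ sft G) {ν : Measure (Config d A₁)} (hν : ν ∈ sftMeasures F) :
    ν.map T.toMap ∈ sftMeasures G := by
  refine ⟨map_mem_invMeasures hν.1 T.measurable_toMap T.toMap_shift, ?_⟩
  rw [ae_map_iff (p := (· ∈ sft G)) T.measurable_toMap.aemeasurable (measurableSet_sft hG)]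
  filter_upwards [hν.2] with x hx using hT x hx

/-- Stability of `Ω_F` passes to `Ω_G`, using only that `T'` maps `Ω_G` to `Ω_F`, that `T` maps
`Ω_F` to `Ω_G`, and that `T ∘ T'` is the identity on `Ω_G`. -/
theorem stable_of_localRules [Finite A₁] [MeasurableSpace A₁] [DiscreteMeasurableSpace A₁]
    [Finite A₂] [MeasurableSpace A₂] [DiscreteMeasurableSpace A₂] [Nonempty A₁]
    {F : Finset (Pattern d A₁)} {G : Finset (Pattern d A₂)}
    (hG : (sft (G : Set (Pattern d A₂))).Nonempty)
    (T : LocalRule d A₁ A₂) (T' : LocalRule d A₂ A₁)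
    (hT : ∀ x ∈ sft (F : Set (Pattern d A₁)), T.toMap x ∈ sft (G : Set (Pattern d A₂)))
    (hT' : ∀ y ∈ sft (G : Set (Pattern d A₂)), T'.toMap y ∈ sft (F : Set (Pattern d A₁)))
    (hTT' : ∀ y ∈ sft (G : Set (Pattern d A₂)), T.toMap (T'.toMap y) = y)
    {N : Set (Measure (Config d Bool))} {f : I → ℝ≥0}
    (hf : Stable (F : Set (Pattern d A₁)) (thickenClass (T'.radius G F) N) f) :
    Stable (G : Set (Pattern d A₂)) N (newSpeed T.constD (T'.constC G F) (constE T T' G) f) := by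
  refine ⟨isSpeed_newSpeed hf.1 _ _ _, ?_⟩
  rintro ε _ ⟨l, hl, rfl⟩
  change (⨅ ν ∈ sftMeasures (G : Set (Pattern d A₂)), besicovitchDist (l.map proj₁) ν) ≤ _
  set r := T'.radius G F with hr
  set ε' : I := Set.projIcc 0 1 zero_le_one ((T'.constC G F : ℝ) * (ε : ℝ))
  have hm : Measurable (T'.noisyMap r) :=
    measurable_zip (T'.measurable_toMap.comp measurable_proj₁)
      ((measurable_thicken r).comp measurable_proj₂)
  have hμ' : (l.map (T'.noisyMap r)).map proj₁ = (l.map proj₁).map T'.toMap := by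
    rw [Measure.map_map measurable_proj₁ hm, Measure.map_map T'.measurable_toMap measurable_proj₁]
    rfl
  have hinv : l.map proj₁ ∈ invMeasures d A₂ :=
    map_mem_invMeasures hl.1.1 measurable_proj₁ fun k z => proj₁_shift k z
  have hstab := hf.2 ε' ((l.map proj₁).map T'.toMap)
    ⟨_, T'.map_noisyMap_mem hG hT' hl, hμ'⟩
  have hval : ((newSpeed T.constD (T'.constC G F) (constE T T' G) f ε : ℝ≥0) : ℝ≥0∞) =
      T.constD * f ε' + constE T T' G * ENNReal.ofReal ε := by
    simp [newSpeed, ENNReal.ofReal, ε']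
  rw [hval]
  have hstep : ∀ t : ℝ≥0∞, (f ε' : ℝ≥0∞) < t →
      (⨅ ν ∈ sftMeasures (G : Set (Pattern d A₂)), besicovitchDist (l.map proj₁) ν) ≤
        T.constD * t + constE T T' G * ENNReal.ofReal ε := fun t ht => by
    have hlt := hstab.trans_lt ht
    simp only [besicovitchDist_eq, iInf_lt_iff] at hlt
    obtain ⟨ν, hν, κ, hκ, hκt⟩ := hlt
    obtain ⟨π, hπ, hπle⟩ := exists_coupling_map T T' hinv hκ
    calc _ ≤ besicovitchDist (l.map proj₁) (ν.map T.toMap) :=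
          iInf₂_le _ (T.map_toMap_mem_sftMeasures G.countable_toSet hT hν)
      _ ≤ π {z | (z 0).1 ≠ (z 0).2} := by
          rw [besicovitchDist_eq]
          exact iInf₂_le _ hπ
      _ ≤ _ := hπle
      _ ≤ constE T T' G * ENNReal.ofReal ε + T.constD * t := by
          gcongr
          exact measure_toMap_toMap_ne_le hG T T' hTT' hl
      _ = _ := add_comm _ _
  -- The infima need not be attained: `t` is let decrease to `f ε'`.
  have hcont : Tendsto (fun δ : ℝ≥0∞ => T.constD * ((f ε' : ℝ≥0∞) + δ) +
      constE T T' G * ENNReal.ofReal ε) (𝓝[>] 0) (𝓝 (T.constD * ((f ε' : ℝ≥0∞) + 0) +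
      constE T T' G * ENNReal.ofReal ε)) := by
    refine Tendsto.mono_left ?_ nhdsWithin_le_nhds
    exact (ENNReal.Tendsto.const_mul (tendsto_const_nhds.add tendsto_id)
      (.inr (ENNReal.natCast_ne_top _))).add tendsto_const_nhds
  rw [add_zero] at hcont
  refine ge_of_tendsto hcont ?_
  filter_upwards [self_mem_nhdsWithin] with δ hδ
  exact hstep _ (ENNReal.lt_add_right ENNReal.coe_ne_top (ne_of_gt hδ))

end

end SFTStability

theorem mainTheorem5 (d : ℕ) (hd : 0 < d) {A₁ A₂ : Type*}
    [Finite A₁] [TopologicalSpace A₁] [DiscreteTopology A₁]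
    [MeasurableSpace A₁] [DiscreteMeasurableSpace A₁]
    [Finite A₂] [TopologicalSpace A₂] [DiscreteTopology A₂]
    [MeasurableSpace A₂] [DiscreteMeasurableSpace A₂]
    (F : Finset (SFTStability.Pattern d A₁)) (G : Finset (SFTStability.Pattern d A₂))
    (hF : (SFTStability.sft (F : Set (SFTStability.Pattern d A₁))).Nonempty)
    (θ : SFTStability.sft (F : Set (SFTStability.Pattern d A₁)) ≃
      SFTStability.sft (G : Set (SFTStability.Pattern d A₂)))
    (hθ : SFTStability.IsConjugacy θ) :
    (∃ T : SFTStability.LocalRule d A₁ A₂, T.Defines θ) ∧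
    (∃ T' : SFTStability.LocalRule d A₂ A₁, T'.Defines θ.symm) ∧
    ∀ (T : SFTStability.LocalRule d A₁ A₂) (T' : SFTStability.LocalRule d A₂ A₁),
      T.Defines θ → T'.Defines θ.symm →
      ∀ N ⊆ SFTStability.invMeasures d Bool, ∀ f : unitInterval → NNReal,
        SFTStability.Stable (F : Set (SFTStability.Pattern d A₁))
          (SFTStability.thickenClass (T'.radius G F) N) f →
        SFTStability.Stable (G : Set (SFTStability.Pattern d A₂)) N
          (SFTStability.newSpeed T.constD (T'.constC G F) (SFTStability.constE T T' G) f) := by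
  obtain ⟨x₀, hx₀⟩ := hF
  have hG : (SFTStability.sft (G : Set (SFTStability.Pattern d A₂))).Nonempty :=
    ⟨_, (θ ⟨x₀, hx₀⟩).2⟩
  have : Nonempty A₁ := ⟨x₀ 0⟩
  refine ⟨SFTStability.exists_localRule_defines ⟨x₀, hx₀⟩ hθ.1 hθ.2,
    SFTStability.exists_localRule_defines hG hθ.continuous_symm hθ.symm_shift, ?_⟩
  intro T T' hT hT' N _ f hf
  refine SFTStability.stable_of_localRules hG T T' (fun x hx => ?_) (fun y hy => ?_)
    (fun y hy => ?_) hf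
  · rw [hT ⟨x, hx⟩]
    exact (θ ⟨x, hx⟩).2
  · rw [hT' ⟨y, hy⟩]
    exact (θ.symm ⟨y, hy⟩).2
  · rw [hT' ⟨y, hy⟩, hT, Equiv.apply_symm_apply]
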